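/- **Theorem 5.5 (Dual moment formula).** Let $E$ be a locally compact Polish space; let $E^\Delta$ be its one-point compactification if $E$ is non-compact, and $E^\Delta=E$ if $E$ is compact. Let $M(E^\Delta)$ be the space of finite signed Borel measures on $E^\Delta$ with the topology of weak convergence, $M_+(E^\Delta)\subseteq M(E^\Delta)$ the finite non-negative measures, and $M_+(E)\subseteq M_+(E^\Delta)$ those that are (images of) finite measures on $E$. Let $\widehat C_\Delta(E^k)$ be the space of symmetric functions in $C((E^\Delta)^k)$ (identified with their restrictions to $E^k$) with the supremum norm, and $\widehat C_\Delta(E^0)=\mathbb R$. For $g\in\widehat C_\Delta(E^k)$ put $\langle g,\nu^k\rangle=\int g(x_1,\dots,x_k)\,\nu(dx_1)\cdots\nu(dx_k)$. A polynomial is a function $p(\nu)=\sum_{k=0}^m\langle g_k,\nu^k\rangle$ with $g_k\in\widehat C_\Delta(E^k)$; its degree is the largest $k$ with $g_k\neq0$ ($-\infty$ if there is none), and $P$ is the set of polynomials; polynomials and cylindrical functions on $M(E)$ are identified with their unique extensions to $M(E^\Delta)$. Let $D\subseteq C(E^\Delta)$ be a dense linear subspace containing the constant function $1$, and let $D^{\otimes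 k}=\operatorname{span}\{g^{\otimes k}: g\in D\}$, where $g^{\otimes k}(x_1,\dots,x_k)=\prod_i g(x_i)$. Let $P^D$ be the set of functions $\nu\mapsto\phi(\langle g_1,\nu\rangle,\dots,\langle g_n,\nu\rangle)$ with $n\in\mathbb N_0$, $g_i\in D$ and $\phi$ a polynomial on $\mathbb R^n$, let $F^D$ be the set of such functions with $\phi\in C_0^\infty(\mathbb R^n)$ (smooth and vanishing at infinity) instead, and let $\mathcal D=\operatorname{span}\{P^D,F^D\}$. Let $L$ be an $M_+(E)$-polynomial operator, that is, a linear operator from $\mathcal D$ to the Borel measurable real functions on $M(E^\Delta)$ that maps $P^D$ to $P$ and such that for every $p\in P^D$ there is $q\in P$ with $q=Lp$ on $M_+(E)$ and $\deg q\le\deg p$. Fix $m\in\mathbb N_0$ and let $L_m:\bigoplus_{k=0}^m D^{\otimes k}\to\bigoplus_{k=0}^m\widehat C_\Delta(E^k)$ be the $m$-th dual operator of $L$, that is, the linear operator such that, for $p(\nu)=\sum_{k=0}^m\langle g_k,\nu^k\rangle$, $$Lp(\nu)=\sum_{k=0}^m\langle L_m^k\vec g,\nu^k\rangle\qquad\text{for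 all }\nu\in M_+(E),$$ where $L_m\vec g=(L_m^0\vec g,\dots,L_m^m\vec g)$. Assume that $L_m$ is closable, and denote its closure again by $L_m$, with domain $\mathcal D(L_m)$. Let $X=(X_t)_{t\ge0}$ be an $M_+(E^\Delta)$-valued solution of the martingale problem for $L$ with some initial condition $\nu_0\in M_+(E^\Delta)$: on a filtered probability space $(\Omega,\mathcal F,(\mathcal F_t)_{t\ge0},\mathbb P)$, $X$ is adapted with càdlàg paths in $M_+(E^\Delta)$, $X_0=\nu_0$ almost surely, and for every $f\in\mathcal D$ the function $s\mapsto Lf(X_s)$ is almost surely integrable on bounded intervals and $$N^f_t=f(X_t)-f(X_0)-\int_0^tLf(X_s)\,ds$$ is a local martingale. Let $T\ge0$, let $\vec g\in\mathcal D(L_m)$, and suppose that the $(m+1)$-dimensional system $\partial_t\vec g_t=L_m\vec g_t$, $\vec g_0=\vec g$, has a solution on $[0,T]$ in the following weak sense: $t\mapsto\vec g_t$ is a function on $[0,T]$ with values in $\mathcal D(L_m)$, $\vec g_0=\vec g$, and for every $t\in(0,T]$ and every $\nu\in M_+(E^\Delta)$ the function $s\mapsto\sum_{k=0}^m\langle L_m^k\vec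 g_s,\nu^k\rangle$ is integrable on $[0,t]$ and $$\sum_{k=0}^m\langle g_{t,k},\nu^k\rangle=\sum_{k=0}^m\langle g_{0,k},\nu^k\rangle+\int_0^t\sum_{k=0}^m\langle L_m^k\vec g_s,\nu^k\rangle\,ds .$$ Then for every such solution and all $0\le t\le T$ the random variable $\sum_{k=0}^m\langle g_k,X_T^k\rangle$ is integrable and $$\mathbb E\Big[\sum_{k=0}^m\langle g_k,X_T^k\rangle\,\Big|\,\mathcal F_t\Big]=\sum_{k=0}^m\langle g_{T-t,k},X_t^k\rangle\qquad\text{almost surely.}$$ -/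

import Mathlib

open MeasureTheory ProbabilityTheory Filter Set Topology
open scoped NNReal ENNReal

noncomputable section

/-! ### The compactification `E^Δ` -/

/-- `E^Δ`: the closure of `E` inside `E ∪ {∞}`. This is the one-point compactification if `E` is
not compact, and `E` itself if `E` is compact (then `∞` is isolated and not in the closure). -/
def EDelta (E : Type*) [TopologicalSpace E] : Type _ :=
  ↥(closure (Set.range ((↑) : E → OnePoint E)))

namespace EDelta

instance instTopologicalSpace (E : Type*) [TopologicalSpace E] : TopologicalSpace (EDelta E) :=
  inferInstanceAs (TopologicalSpace ↥(closure (Set.range ((↑) : E → OnePoint E))))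

instance instCompactSpace (E : Type*) [TopologicalSpace E] : CompactSpace (EDelta E) :=
  isCompact_iff_compactSpace.mp
    (isClosed_closure (s := Set.range ((↑) : E → OnePoint E))).isCompact

instance instT2Space (E : Type*) [TopologicalSpace E] [T2Space E] [LocallyCompactSpace E] :
    T2Space (EDelta E) :=
  inferInstanceAs (T2Space ↥(closure (Set.range ((↑) : E → OnePoint E))))

instance instMeasurableSpace (E : Type*) [TopologicalSpace E] : MeasurableSpace (EDelta E) :=
  borel _

instance instBorelSpace (E : Type*) [TopologicalSpace E] : BorelSpace (EDelta E) := ⟨rfl⟩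

/-- The inclusion of `E` into `E^Δ`. -/
def incl {E : Type*} [TopologicalSpace E] (x : E) : EDelta E :=
  ⟨(x : OnePoint E), subset_closure (Set.mem_range_self x)⟩

end EDelta

/-! ### Symmetric coefficients

Throughout, `C_Δ(E^k)` is identified with the continuous functions on `(E^Δ)^k`. The definitions
below are written for a topological space `K` that plays the role of `E^Δ`. -/

/-- The symmetric continuous functions of `k` variables. -/
def SymC (K : Type*) [TopologicalSpace K] (k : ℕ) : Submodule ℝ C(Fin k → K, ℝ) where
  carrier := {g | ∀ (σ : Equiv.Perm (Fin k)) (x : Fin k → K), g (fun i => x (σ i)) = g x}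
  add_mem' {f g} hf hg σ x := by
    simp only [ContinuousMap.add_apply]; rw [hf σ x, hg σ x]
  zero_mem' _ _ := rfl
  smul_mem' c f hf σ x := by
    simp only [ContinuousMap.smul_apply]; rw [hf σ x]

/-- Coefficient vectors `(g_0, …, g_m)`, with the topology of the direct sum; for compact `K` the
topology on each component is that of uniform convergence. -/
abbrev Coeff (K : Type*) [TopologicalSpace K] (m : ℕ) : Type _ := (k : Fin (m + 1)) → SymC K k

/-- The function `f ⊗ ⋯ ⊗ f` of `k` variables. -/
def tensorPow {K : Type*} [TopologicalSpace K] (f : C(K, ℝ)) (k : ℕ) : SymC K k :=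
  ⟨⟨fun x => ∏ i, f (x i), by fun_prop⟩, fun σ x => Equiv.prod_comp σ fun i => f (x i)⟩

/-- `D^{⊗k}`, the span of the functions `f ⊗ ⋯ ⊗ f` with `f ∈ D`. -/
def tensorSpan {K : Type*} [TopologicalSpace K] (D : Submodule ℝ C(K, ℝ)) (k : ℕ) :
    Submodule ℝ (SymC K k) :=
  Submodule.span ℝ {u | ∃ f ∈ D, u = tensorPow f k}

/-! ### Monomials and polynomials of measures -/

/-- `⟨f, ν⟩` for a signed measure `ν`. -/
def linPair {K : Type*} [MeasurableSpace K] (f : K → ℝ) (ν : SignedMeasure K) : ℝ :=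
  (∫ x, f x ∂ν.toJordanDecomposition.posPart) - ∫ x, f x ∂ν.toJordanDecomposition.negPart

/-- `⟨g, ν^k⟩` for a signed measure `ν = ν⁺ - ν⁻`, with the product `ν^k` expanded into products
of `ν⁺` and `ν⁻`. -/
def signedMonomial {K : Type*} [MeasurableSpace K] {k : ℕ} (g : (Fin k → K) → ℝ)
    (ν : SignedMeasure K) : ℝ :=
  ∑ s : Fin k → Bool, (∏ i, if s i then (1 : ℝ) else -1) *
    ∫ x, g x ∂(Measure.pi fun i => if s i then ν.toJordanDecomposition.posPart
      else ν.toJordanDecomposition.negPart)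

/-- `⟨g, ν^k⟩` for a finite measure `ν`. -/
def posMonomial {K : Type*} [MeasurableSpace K] {k : ℕ} (g : (Fin k → K) → ℝ)
    (ν : FiniteMeasure K) : ℝ :=
  ∫ x, g x ∂(Measure.pi fun _ => (ν : Measure K))

/-- A finite measure, regarded as a signed measure. -/
def toSigned {K : Type*} [MeasurableSpace K] (ν : FiniteMeasure K) : SignedMeasure K :=
  (ν : Measure K).toSignedMeasure

/-- The polynomial `ν ↦ ∑_{k ≤ m} ⟨g_k, ν^k⟩` on signed measures. -/
def signedPoly {K : Type*} [TopologicalSpace K] [MeasurableSpace K] {m : ℕ} (g : Coeff K m)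
    (ν : SignedMeasure K) : ℝ :=
  ∑ k : Fin (m + 1), signedMonomial (g k : C(Fin k → K, ℝ)) ν

/-- The polynomial `ν ↦ ∑_{k ≤ m} ⟨g_k, ν^k⟩` on finite measures. -/
def poly {K : Type*} [TopologicalSpace K] [MeasurableSpace K] {m : ℕ} (g : Coeff K m)
    (ν : FiniteMeasure K) : ℝ :=
  ∑ k : Fin (m + 1), posMonomial (g k : C(Fin k → K, ℝ)) ν

theorem toJordanDecomposition_toSigned {K : Type*} [MeasurableSpace K] (ν : FiniteMeasure K) :
    (toSigned ν).toJordanDecomposition =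
      { posPart := (ν : Measure K), negPart := 0,
        mutuallySingular := Measure.MutuallySingular.zero_right } := by
  apply SignedMeasure.toJordanDecomposition_eq
  simp [toSigned, JordanDecomposition.toSignedMeasure]

theorem linPair_toSigned {K : Type*} [MeasurableSpace K] (f : K → ℝ) (ν : FiniteMeasure K) :
    linPair f (toSigned ν) = ∫ x, f x ∂(ν : Measure K) := by
  simp [linPair, toJordanDecomposition_toSigned]

/-- On finite measures the two definitions of a monomial agree. -/
theorem signedMonomial_toSigned {K : Type*} [MeasurableSpace K] {k : ℕ} (g : (Fin k → K) → ℝ)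
    (ν : FiniteMeasure K) : signedMonomial g (toSigned ν) = posMonomial g ν := by
  unfold signedMonomial posMonomial
  rw [toJordanDecomposition_toSigned]
  rw [Finset.sum_eq_single (fun _ => true)]
  · simp
  · intro s _ hs
    obtain ⟨i, hi⟩ : ∃ i, s i = false := by
      by_contra! h
      exact hs (funext fun i => by simpa using h i)
    have : (Measure.pi fun i => if s i then (ν : Measure K) else 0) = 0 := by
      have : ∀ i, IsFiniteMeasure (if s i then (ν : Measure K) else 0) := by
        intro i; split_ifs <;> infer_instance
      rw [← Measure.measure_univ_eq_zero, Measure.pi_univ]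
      exact Finset.prod_eq_zero (Finset.mem_univ i) (by simp [hi])
    simp [this]
  · simp

theorem signedPoly_toSigned {K : Type*} [TopologicalSpace K] [MeasurableSpace K] {m : ℕ}
    (g : Coeff K m) (ν : FiniteMeasure K) : signedPoly g (toSigned ν) = poly g ν := by
  simp [signedPoly, poly, signedMonomial_toSigned]

/-- The set `P` of polynomials, regarded as functions on signed measures. -/
def polynomials (K : Type*) [TopologicalSpace K] [MeasurableSpace K] :
    Set (SignedMeasure K → ℝ) :=
  {p | ∃ (m : ℕ) (g : Coeff K m), p = signedPoly g}

open scoped Classical in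
/-- The largest `k` with `g_k ≠ 0`; it is `⊥` if there is none. -/
def coeffDegree {K : Type*} [TopologicalSpace K] {m : ℕ} (g : Coeff K m) : WithBot ℕ :=
  (Finset.univ.filter fun k => g k ≠ 0).sup fun k => ((k : ℕ) : WithBot ℕ)

/-- The degree of a polynomial: the degree of its (unique) coefficient vector. -/
def polyDegree {K : Type*} [TopologicalSpace K] [MeasurableSpace K]
    (p : SignedMeasure K → ℝ) : WithBot ℕ :=
  sInf {d | ∃ (m : ℕ) (g : Coeff K m), p = signedPoly g ∧ d = coeffDegree g}

/-! ### Cylindrical polynomials, cylindrical functions, polynomial operators -/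

/-- The set `P^D` of cylindrical polynomials. -/
def cylPoly {K : Type*} [TopologicalSpace K] [MeasurableSpace K] (D : Submodule ℝ C(K, ℝ)) :
    Set (SignedMeasure K → ℝ) :=
  {p | ∃ (n : ℕ) (φ : MvPolynomial (Fin n) ℝ) (f : Fin n → D),
    p = fun ν => MvPolynomial.eval (fun i => linPair (f i : C(K, ℝ)) ν) φ}

/-- The set `F^D` of cylindrical functions, built from smooth functions vanishing at infinity. -/
def cylFun {K : Type*} [TopologicalSpace K] [MeasurableSpace K] (D : Submodule ℝ C(K, ℝ)) :
    Set (SignedMeasure K → ℝ) :=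
  {p | ∃ (n : ℕ) (φ : (Fin n → ℝ) → ℝ) (f : Fin n → D),
    ContDiff ℝ ((⊤ : ℕ∞) : WithTop ℕ∞) φ ∧ Tendsto φ (cocompact (Fin n → ℝ)) (𝓝 0) ∧
      p = fun ν => φ (fun i => linPair (f i : C(K, ℝ)) ν)}

/-- The domain `𝒟 = span {P^D, F^D}`. -/
def cylDomain {K : Type*} [TopologicalSpace K] [MeasurableSpace K] (D : Submodule ℝ C(K, ℝ)) :
    Submodule ℝ (SignedMeasure K → ℝ) :=
  Submodule.span ℝ (cylPoly D ∪ cylFun D)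

/-- The topology of weak convergence on signed measures (for compact `K`). -/
@[reducible] def weakTopology (K : Type*) [TopologicalSpace K] [MeasurableSpace K] :
    TopologicalSpace (SignedMeasure K) :=
  ⨅ f : C(K, ℝ), TopologicalSpace.induced (fun ν => linPair f ν) inferInstance

/-- The Borel measurable real-valued maps on the space of signed measures. -/
def measurableMaps (K : Type*) [TopologicalSpace K] [MeasurableSpace K] :
    Submodule ℝ (SignedMeasure K → ℝ) where
  carrier := {f | @Measurable _ _ (@borel _ (weakTopology K)) _ f}
  add_mem' hf hg := by
    let _ : MeasurableSpace (SignedMeasure K) := @borel _ (weakTopology K)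
    exact Measurable.add hf hg
  zero_mem' := by
    let _ : MeasurableSpace (SignedMeasure K) := @borel _ (weakTopology K)
    exact measurable_const
  smul_mem' c f hf := by
    let _ : MeasurableSpace (SignedMeasure K) := @borel _ (weakTopology K)
    exact Measurable.const_smul hf c

/-- `L` is `S`-polynomial: it maps `P^D` to `P`, and on `S` it does not increase the degree. -/
def IsPolynomialOperator {K : Type*} [TopologicalSpace K] [MeasurableSpace K]
    (D : Submodule ℝ C(K, ℝ)) (S : Set (SignedMeasure K))
    (L : cylDomain D →ₗ[ℝ] measurableMaps K) : Prop :=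
  ∀ p : cylDomain D, (p : SignedMeasure K → ℝ) ∈ cylPoly D →
    (L p : SignedMeasure K → ℝ) ∈ polynomials K ∧
    ∃ q ∈ polynomials K, (∀ ν ∈ S, q ν = (L p : SignedMeasure K → ℝ) ν) ∧
      polyDegree q ≤ polyDegree (p : SignedMeasure K → ℝ)

/-- `M_+(E)` as a set of signed measures on `E^Δ`: the images of the finite measures on `E`. -/
def MPlus (E : Type*) [TopologicalSpace E] [MeasurableSpace E] : Set (SignedMeasure (EDelta E)) :=
  {ν | ∃ μ : FiniteMeasure E, ν = ((μ : Measure E).map EDelta.incl).toSignedMeasure}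

/-! ### Dual operators -/

/-- `A` is an `m`-th dual operator of the `S`-polynomial operator `L`: it is defined on
`⨁_{k ≤ m} D^{⊗k}` and maps the coefficient vector of `p` to one of `L p` on `S`. -/
def IsDualOperator {K : Type*} [TopologicalSpace K] [MeasurableSpace K]
    (D : Submodule ℝ C(K, ℝ)) (S : Set (SignedMeasure K))
    (L : cylDomain D →ₗ[ℝ] measurableMaps K) (m : ℕ) (A : Coeff K m →ₗ.[ℝ] Coeff K m) : Prop :=
  A.domain = Submodule.pi Set.univ (fun k : Fin (m + 1) => tensorSpan D k) ∧
  ∀ (g : A.domain) (p : cylDomain D), (p : SignedMeasure K → ℝ) = signedPoly (g : Coeff K m) →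
    ∀ ν ∈ S, (L p : SignedMeasure K → ℝ) ν = signedPoly (A g) ν

/-- `g` is a solution on `[0, T]` of `∂_t g_t = A g_t`, `g_0 = g₀`, in the weak sense: tested
against every finite measure, in integrated form. (Values of `g` outside `[0, T]` play no role.) -/
def IsWeakSolution {K : Type*} [TopologicalSpace K] [MeasurableSpace K] {m : ℕ}
    (A : Coeff K m →ₗ.[ℝ] Coeff K m) (T : ℝ) (g₀ : A.domain) (g : ℝ → A.domain) : Prop :=
  g 0 = g₀ ∧ ∀ t : ℝ, 0 < t → t ≤ T → ∀ ν : FiniteMeasure K,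
    IntervalIntegrable (fun s => poly (A (g s)) ν) volume 0 t ∧
    poly (g t : Coeff K m) ν = poly (g 0 : Coeff K m) ν + ∫ s in (0 : ℝ)..t, poly (A (g s)) ν

/-! ### The martingale problem -/

/-- Right-continuous with left limits. -/
def IsCadlag {S : Type*} [TopologicalSpace S] (x : ℝ≥0 → S) : Prop :=
  ∀ t, ContinuousWithinAt x (Set.Ici t) t ∧ ∃ l, Tendsto x (𝓝[<] t) (𝓝 l)

/-- `N^f_t = f(X_t) - f(X_0) - ∫_0^t (Lf)(X_s) ds`, where `h = Lf`. -/
def mgProcess {K Ω : Type*} [MeasurableSpace K] (f h : SignedMeasure K → ℝ)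
    (X : ℝ≥0 → Ω → FiniteMeasure K) (t : ℝ≥0) (ω : Ω) : ℝ :=
  f (toSigned (X t ω)) - f (toSigned (X 0 ω)) -
    ∫ s in (0 : ℝ)..t, h (toSigned (X s.toNNReal ω))

/-- `X` is a solution, with values in the finite measures on `K`, of the martingale problem for `L`
with initial condition `ν₀` on the filtered probability space `(Ω, ℱ, P)`. -/
structure SolvesMartingaleProblem {K : Type*} [TopologicalSpace K] [MeasurableSpace K]
    [BorelSpace K] {D : Submodule ℝ C(K, ℝ)} (L : cylDomain D →ₗ[ℝ] measurableMaps K)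
    {Ω : Type*} [mΩ : MeasurableSpace Ω] (P : Measure Ω) (ℱ : Filtration ℝ≥0 mΩ)
    (ν₀ : FiniteMeasure K) (X : ℝ≥0 → Ω → FiniteMeasure K) : Prop where
  adapted : StronglyAdapted ℱ X
  cadlag : ∀ ω, IsCadlag fun t => X t ω
  initial : ∀ᵐ ω ∂P, X 0 ω = ν₀
  integrable : ∀ f : cylDomain D, ∀ᵐ ω ∂P, ∀ t : ℝ≥0,
    IntervalIntegrable (fun s : ℝ => (L f : SignedMeasure K → ℝ) (toSigned (X s.toNNReal ω)))
      volume 0 t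
  local_martingale : ∀ f : cylDomain D,
    Locally (fun N => Martingale N ℱ P) ℱ
      (mgProcess (f : SignedMeasure K → ℝ) (L f : SignedMeasure K → ℝ) X) P

end

/-! Write `T = t + S` and ⟨g, ν⟩ = ∑ₖ ⟨g_k, ν^k⟩, fix `A ∈ ℱ t`, and put F(a, b) = E[1_A ⟨g_a,
X_{t+b}⟩] for a, b ∈ [0, S]. The weak equation, tested with ν = X_{t+b}(ω), gives ∂F/∂a = ψ, and the
martingale problem gives ∂F/∂b = ψ with the same ψ(a, b) = E[1_A ⟨L_m g_a, X_{t+b}⟩]. So F is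
constant along antidiagonals, and F(S, 0) = F(0, S) is the claimed identity integrated over `A`. As
`g` has no regularity in time beyond the integrated equation, both derivatives are used in integral
form and compared by Fubini on a triangle (`eq_swap_of_partial_integrals_eq`). What remains is to
justify this calculation.

Moments. `L` does not raise degrees, so the drift of 1 + ⟨1, ν⟩^k is at most a multiple of that
function; a pathwise Gronwall estimate and Fatou bound all moments of the total mass
(`integrable_of_locally_martingale_of_le`).

True martingales. For a polynomial p of degree d, adding ε ⟨1, ν⟩^(d+1) makes it bounded below. The
compensated local martingale is then bounded below by an integrable variable, hence a
supermartingale. Letting ε → 0 and treating -p likewise gives the martingale property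
(`setIntegral_sub_sub_eq_zero`).

Boundary and closure. The hypotheses on `L` concern measures on `E`, while `X` may charge the added
point; density of these measures and continuity of polynomials bridge the gap. The integrated
martingale identity is a closed linear condition on the pair (g, L_m g), so it survives passage to
the closure of `L_m` (`eq_map_closure_of_isClosable`).

Joint integrability. The weak equation gives integrability of s ↦ ⟨L_m g_s, ν⟩ for each ν
separately. Baire's theorem on the cone of positive functionals makes the bound uniform on a ball,
and Lagrange interpolation along lines of measures carries it to every ν, with growth 1 + mass^m
(`exists_lintegral_enorm_poly_le`). With the moment bounds this yields integrability in both times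
and ω. -/

noncomputable section

/-! ### Product functions on powers of a compact space -/

section ProductFunctions

set_option linter.unusedSectionVars false

variable {K : Type*} [TopologicalSpace K] {k : ℕ}

/-- The function `f_1 ⊗ ⋯ ⊗ f_k`. -/
def tensorProd (f : Fin k → C(K, ℝ)) : C(Fin k → K, ℝ) :=
  ⟨fun x => ∏ i, f i (x i), by fun_prop⟩

/-- The functions `f_1 ⊗ ⋯ ⊗ f_k` form a monoid under multiplication. -/
def tensorProdMonoid (K : Type*) [TopologicalSpace K] (k : ℕ) : Submonoid C(Fin k → K, ℝ) where
  carrier := Set.range tensorProd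
  mul_mem' := by
    rintro _ _ ⟨f, rfl⟩ ⟨g, rfl⟩
    exact ⟨fun i => f i * g i, by ext x; simp [tensorProd, Finset.prod_mul_distrib]⟩
  one_mem' := ⟨fun _ => 1, by ext x; simp [tensorProd]⟩

/-- Stone–Weierstrass: products of tensor products are tensor products, so their span is already an
algebra, and a Urysohn function of one coordinate separates points. -/
theorem dense_span_tensorProd [CompactSpace K] [T2Space K] :
    Dense (Submodule.span ℝ (Set.range (tensorProd (K := K) (k := k))) :
      Set C(Fin k → K, ℝ)) := by
  have h1 : Subalgebra.toSubmodule (Algebra.adjoin ℝ (Set.range (tensorProd (K := K) (k := k)))) =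
      Submodule.span ℝ (Set.range (tensorProd (K := K) (k := k))) := by
    rw [Algebra.adjoin_eq_span]
    congr 1
    exact congrArg SetLike.coe (Submonoid.closure_eq (tensorProdMonoid K k))
  have h2 := ContinuousMap.subalgebra_topologicalClosure_eq_top_of_separatesPoints
    (Algebra.adjoin ℝ (Set.range (tensorProd (K := K) (k := k)))) (by
      intro x y hxy
      obtain ⟨i, hi⟩ := Function.ne_iff.mp hxy
      obtain ⟨f, hf0, hf1, -⟩ := exists_continuous_zero_one_of_isClosed (isClosed_singleton (x := x i))
        (isClosed_singleton (x := y i)) (by simpa using hi)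
      refine ⟨_, ⟨tensorProd (Function.update 1 i f), Algebra.subset_adjoin ⟨_, rfl⟩, rfl⟩, ?_⟩
      have (z : Fin k → K) : tensorProd (Function.update 1 i f) z = f (z i) := by
        simp only [tensorProd, ContinuousMap.coe_mk]
        rw [Finset.prod_eq_single i]
        · simp
        · intro j _ hj; simp [hj]
        · simp
      have hx := hf0 (mem_singleton (x i))
      have hy := hf1 (mem_singleton (y i))
      change tensorProd _ x ≠ tensorProd _ y
      rw [this, this, hx, hy]
      simp)
  rw [← h1, dense_iff_closure_eq]
  exact congrArg (SetLike.coe) h2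

variable [MeasurableSpace K] [BorelSpace K]

theorem measurable_tensorProd (f : Fin k → C(K, ℝ)) : Measurable (tensorProd f) := by
  simp only [tensorProd, ContinuousMap.coe_mk]
  exact Finset.measurable_fun_prod _ fun i _ => (f i).continuous.measurable.comp (measurable_pi_apply i)

variable [CompactSpace K] [T2Space K]

/-- Continuous functions on a power of a compact Hausdorff space are measurable for the product
`σ`-algebra, which may be smaller than the Borel `σ`-algebra. -/
theorem measurable_pi_of_continuous (g : C(Fin k → K, ℝ)) : Measurable g := by
  have hg := dense_span_tensorProd (K := K) (k := k) g
  rw [mem_closure_iff_seq_limit] at hg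
  obtain ⟨u, hu, hlim⟩ := hg
  refine measurable_of_tendsto_metrizable (f := fun n => ⇑(u n)) (fun n => ?_)
    (tendsto_pi_nhds.mpr fun x => ((continuous_eval_const x).tendsto g).comp hlim)
  refine Submodule.span_induction (p := fun (g : C(Fin k → K, ℝ)) _ => Measurable g)
    ?_ ?_ ?_ ?_ (hu n)
  · rintro _ ⟨f, rfl⟩; exact measurable_tensorProd f
  · exact measurable_const
  · intro f g _ _ hf hg; exact hf.add hg
  · intro c f _ hf; exact hf.const_smul c

theorem integrable_pi_of_continuous (ρ : Measure (Fin k → K)) [IsFiniteMeasure ρ]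
    (g : C(Fin k → K, ℝ)) : Integrable g ρ :=
  Integrable.of_bound (measurable_pi_of_continuous g).aestronglyMeasurable ‖g‖
    (ae_of_all _ fun x => g.norm_coe_le_norm x)

/-- Integration of continuous functions of `k` variables against a finite measure. -/
def integralPi (ρ : Measure (Fin k → K)) [IsFiniteMeasure ρ] : C(Fin k → K, ℝ) →L[ℝ] ℝ :=
  LinearMap.mkContinuous
    { toFun g := ∫ x, g x ∂ρ
      map_add' f g := integral_add (integrable_pi_of_continuous ρ f) (integrable_pi_of_continuous ρ g)
      map_smul' c f := integral_const_mul c _ } (ρ.real univ) fun g => by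
    have := norm_integral_le_of_norm_le_const (μ := ρ) (ae_of_all _ fun x => g.norm_coe_le_norm x)
    simpa [mul_comm] using this

@[simp]
theorem integralPi_apply (ρ : Measure (Fin k → K)) [IsFiniteMeasure ρ] (g : C(Fin k → K, ℝ)) :
    integralPi ρ g = ∫ x, g x ∂ρ := rfl

theorem ext_tensorProd {Φ Ψ : C(Fin k → K, ℝ) →L[ℝ] ℝ}
    (h : ∀ f, Φ (tensorProd f) = Ψ (tensorProd f)) (g : C(Fin k → K, ℝ)) : Φ g = Ψ g := by
  have : Φ = Ψ := ContinuousLinearMap.ext_on dense_span_tensorProd (by rintro _ ⟨f, rfl⟩; exact h f)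
  rw [this]

end ProductFunctions

/-! ### Continuity of monomials in the measure -/

section Monomials

set_option linter.unusedSectionVars false

variable {K : Type*} [TopologicalSpace K] [CompactSpace K] [T2Space K] [MeasurableSpace K]
  [BorelSpace K] {k m : ℕ}

theorem posMonomial_tensorProd (f : Fin k → C(K, ℝ)) (ν : FiniteMeasure K) :
    posMonomial (tensorProd f) ν = ∏ i, ∫ x, f i x ∂(ν : Measure K) :=
  integral_fintype_prod_eq_prod (fun i => ⇑(f i)) 

theorem abs_posMonomial_le (g : C(Fin k → K, ℝ)) (ν : FiniteMeasure K) :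
    |posMonomial g ν| ≤ ‖g‖ * (ν.mass : ℝ) ^ k := by
  have := norm_integral_le_of_norm_le_const (μ := Measure.pi fun _ : Fin k => (ν : Measure K))
    (ae_of_all _ fun x => g.norm_coe_le_norm x)
  simpa [Measure.real, Measure.pi_univ, posMonomial, FiniteMeasure.mass, ← FiniteMeasure.ennreal_coeFn_eq_coeFn_toMeasure] using this

/-- For product functions this is weak convergence in each factor. In general, `abs_posMonomial_le`
makes uniform approximation of `g` uniform over measures of bounded mass, and a locally uniform
limit of continuous functions is continuous. -/
theorem continuous_posMonomial (g : C(Fin k → K, ℝ)) :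
    Continuous fun ν : FiniteMeasure K => posMonomial g ν := by
  have hg := dense_span_tensorProd (K := K) (k := k) g
  rw [mem_closure_iff_seq_limit] at hg
  obtain ⟨u, hu, hlim⟩ := hg
  have hcont : ∀ n, Continuous fun ν : FiniteMeasure K => posMonomial (u n) ν := by
    intro n
    refine Submodule.span_induction
      (p := fun (g : C(Fin k → K, ℝ)) _ => Continuous fun ν : FiniteMeasure K => posMonomial g ν)
      ?_ ?_ ?_ ?_ (hu n)
    · rintro _ ⟨f, rfl⟩
      simp only [posMonomial_tensorProd]
      exact continuous_finsetProd _ fun i _ =>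
        FiniteMeasure.continuous_integral_boundedContinuousFunction (BoundedContinuousFunction.mkOfCompact (f i))
    · simpa [posMonomial] using continuous_const
    · intro f g _ _ hf hg
      have : (fun ν : FiniteMeasure K => posMonomial (f + g : C(Fin k → K, ℝ)) ν) =
          fun ν => posMonomial f ν + posMonomial g ν := by
        ext ν; exact map_add (integralPi (Measure.pi fun _ => (ν : Measure K))) f g
      rw [this]; exact hf.add hg
    · intro c f _ hf
      have : (fun ν : FiniteMeasure K => posMonomial (c • f : C(Fin k → K, ℝ)) ν) =
          fun ν => c • posMonomial f ν := by
        ext ν; exact map_smul (integralPi (Measure.pi fun _ => (ν : Measure K))) c f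
      rw [this]; exact hf.const_smul c
  rw [continuous_iff_continuousAt]
  intro ν₀
  have hloc : TendstoLocallyUniformlyOn (fun n ν => posMonomial (u n) ν)
      (fun ν : FiniteMeasure K => posMonomial g ν) atTop {ν | ν.mass < ν₀.mass + 1} := by
    apply TendstoUniformlyOn.tendstoLocallyUniformlyOn
    rw [Metric.tendstoUniformlyOn_iff]
    intro ε hε
    set M : ℝ := ((ν₀.mass : ℝ) + 1) ^ k
    have hM : 0 < M := by positivity
    filter_upwards [Metric.tendsto_nhds.mp hlim (ε / M) (by positivity)] with n h1 ν hν
    rw [dist_eq_norm] at h1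
    have h2 : posMonomial g ν - posMonomial (u n) ν = posMonomial (g - u n : C(Fin k → K, ℝ)) ν :=
      (map_sub (integralPi (Measure.pi fun _ => (ν : Measure K))) g (u n)).symm
    rw [Real.dist_eq, h2]
    refine (abs_posMonomial_le _ ν).trans_lt ?_
    have h3 : (ν.mass : ℝ) ^ k ≤ M := by
      have : (ν.mass : ℝ) ≤ ν₀.mass + 1 := by exact_mod_cast le_of_lt hν
      exact pow_le_pow_left₀ (by positivity) this k
    rw [norm_sub_rev]
    calc _ ≤ ‖u n - g‖ * M := by gcongr
      _ < ε / M * M := by gcongr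
      _ = ε := by field_simp
  have hopen : IsOpen {ν : FiniteMeasure K | ν.mass < ν₀.mass + 1} :=
    isOpen_lt FiniteMeasure.continuous_mass continuous_const
  exact (hloc.continuousOn (Frequently.of_forall fun n => (hcont n).continuousOn)).continuousAt
    (hopen.mem_nhds (by simp))

end Monomials

/-! ### Polynomials of measures and interpolation along lines -/

section PolynomialsOfMeasures

set_option linter.unusedSectionVars false

variable {K : Type*} [TopologicalSpace K] [CompactSpace K] [T2Space K] [MeasurableSpace K]
  [BorelSpace K] {k m : ℕ}

theorem pow_le_one_add_pow {x : ℝ} (hx : 0 ≤ x) {k m : ℕ} (h : k ≤ m) : x ^ k ≤ 1 + x ^ m := by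
  rcases le_total x 1 with h1 | h1
  · linarith [pow_le_one₀ hx h1 (n := k), pow_nonneg hx m]
  · linarith [pow_le_pow_right₀ h1 h]

/-- `ν ↦ ∑_{k ≤ m} ⟨g_k, ν^k⟩` as a linear function of the coefficients. -/
def polyLin (m : ℕ) (ν : FiniteMeasure K) : Coeff K m →ₗ[ℝ] ℝ :=
  ∑ k : Fin (m + 1), (integralPi (Measure.pi fun _ : Fin k => (ν : Measure K))).toLinearMap ∘ₗ
    (SymC K k).subtype ∘ₗ LinearMap.proj k

theorem polyLin_apply (ν : FiniteMeasure K) (g : Coeff K m) : polyLin m ν g = poly g ν := by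
  simp [polyLin, poly, posMonomial]

theorem poly_add (g h : Coeff K m) (ν : FiniteMeasure K) : poly (g + h) ν = poly g ν + poly h ν := by
  simp only [← polyLin_apply, map_add]

theorem poly_smul (c : ℝ) (g : Coeff K m) (ν : FiniteMeasure K) : poly (c • g) ν = c * poly g ν := by
  simp only [← polyLin_apply, map_smul, smul_eq_mul]

theorem abs_poly_le (g : Coeff K m) (ν : FiniteMeasure K) :
    |poly g ν| ≤ (m + 1) * ‖g‖ * (1 + (ν.mass : ℝ) ^ m) := by
  calc |poly g ν| ≤ ∑ k : Fin (m + 1), |posMonomial (g k : C(Fin k → K, ℝ)) ν| :=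
        Finset.abs_sum_le_sum_abs _ _
    _ ≤ ∑ k : Fin (m + 1), ‖g‖ * (1 + (ν.mass : ℝ) ^ m) := by
        refine Finset.sum_le_sum fun k _ => (abs_posMonomial_le _ ν).trans ?_
        have h1 : ‖(g k : C(Fin k → K, ℝ))‖ ≤ ‖g‖ := norm_le_pi_norm g k
        have h2 := pow_le_one_add_pow (NNReal.coe_nonneg ν.mass) (Nat.lt_succ_iff.mp k.2)
        gcongr
    _ = _ := by simp; ring

theorem continuous_poly (g : Coeff K m) : Continuous fun ν : FiniteMeasure K => poly g ν :=
  continuous_finsetSum _ fun _ _ => continuous_posMonomial _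

/-- On a product function the monomial is a product of `k` affine functions of the line parameter,
hence a polynomial of degree at most `m`, determined by its values at `m + 1` nodes. The line is
described through integrals only, so no measure is needed at other parameter values, where
positivity may fail. -/
theorem posMonomial_eq_sum_lagrange (hk : k ≤ m) (g : C(Fin k → K, ℝ)) {x : ℝ}
    {v : Fin (m + 1) → ℝ} (hv : Function.Injective v) (μ : FiniteMeasure K)
    (μ' : Fin (m + 1) → FiniteMeasure K)
    (h : ∀ f : C(K, ℝ), ∃ a b : ℝ, ∫ y, f y ∂(μ : Measure K) = a + x * b ∧
      ∀ j, ∫ y, f y ∂(μ' j : Measure K) = a + v j * b) :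
    posMonomial g μ = ∑ j, (Lagrange.basis Finset.univ v j).eval x * posMonomial g (μ' j) := by
  have key := ext_tensorProd (Φ := integralPi (Measure.pi fun _ : Fin k => (μ : Measure K)))
    (Ψ := ∑ j, (Lagrange.basis Finset.univ v j).eval x •
      integralPi (Measure.pi fun _ : Fin k => (μ' j : Measure K))) (fun f => ?_) g
  · simpa [posMonomial] using key
  · choose a b hab hab' using h
    simp only [integralPi_apply, sum_apply,
      smul_apply, smul_eq_mul]
    have e1 := posMonomial_tensorProd f μ
    have e2 := fun j => posMonomial_tensorProd f (μ' j)
    simp only [posMonomial] at e1 e2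
    simp only [e1, e2, hab, hab']
    set q : Polynomial ℝ := ∏ i, (Polynomial.C (a (f i)) + Polynomial.X * Polynomial.C (b (f i)))
    have hq (y : ℝ) : q.eval y = ∏ i, (a (f i) + y * b (f i)) := by
      simp only [q, Polynomial.eval_prod, Polynomial.eval_add, Polynomial.eval_mul,
        Polynomial.eval_C, Polynomial.eval_X]
    have hdeg : q.degree < (Finset.univ : Finset (Fin (m + 1))).card := by
      refine (Polynomial.degree_prod_le _ _).trans_lt ?_
      calc ∑ i, (Polynomial.C (a (f i)) + Polynomial.X * Polynomial.C (b (f i))).degree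
          ≤ ∑ i : Fin k, (1 : WithBot ℕ) := by
            refine Finset.sum_le_sum fun i _ => ?_
            compute_degree
        _ = (k : WithBot ℕ) := by simp
        _ < _ := by simpa using by exact_mod_cast Nat.lt_succ_of_le hk
    have := congrArg (Polynomial.eval x) (Lagrange.eq_interpolate (s := Finset.univ) hv.injOn hdeg)
    rw [Lagrange.interpolate_apply, Polynomial.eval_finsetSum] at this
    simp only [Polynomial.eval_mul, Polynomial.eval_C, hq] at this
    rw [this]
    exact Finset.sum_congr rfl fun j _ => mul_comm _ _

/-- Along a line of measures a polynomial of degree `m` is given by Lagrange interpolation. -/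
theorem poly_eq_sum_lagrange (g : Coeff K m) {x : ℝ}
    {v : Fin (m + 1) → ℝ} (hv : Function.Injective v) (μ : FiniteMeasure K)
    (μ' : Fin (m + 1) → FiniteMeasure K)
    (h : ∀ f : C(K, ℝ), ∃ a b : ℝ, ∫ y, f y ∂(μ : Measure K) = a + x * b ∧
      ∀ j, ∫ y, f y ∂(μ' j : Measure K) = a + v j * b) :
    poly g μ = ∑ j, (Lagrange.basis Finset.univ v j).eval x * poly g (μ' j) := by
  simp only [poly, Finset.mul_sum]
  rw [Finset.sum_comm]
  exact Finset.sum_congr rfl fun k _ =>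
    posMonomial_eq_sum_lagrange (Nat.lt_succ_iff.mp k.2) _ hv μ μ' h

instance isFiniteMeasure_ite {α : Type*} [MeasurableSpace α] (p : Prop) [Decidable p]
    (μ ν : Measure α) [IsFiniteMeasure μ] [IsFiniteMeasure ν] :
    IsFiniteMeasure (if p then μ else ν) := by
  split_ifs <;> infer_instance

/-- `⟨g, ν^k⟩` as a linear function of `g`, for a signed measure `ν`. -/
def signedMonomialLin (k : ℕ) (ν : SignedMeasure K) : C(Fin k → K, ℝ) →ₗ[ℝ] ℝ :=
  ∑ s : Fin k → Bool, (∏ i, if s i then (1 : ℝ) else -1) •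
    (integralPi (Measure.pi fun i => if s i then ν.toJordanDecomposition.posPart
      else ν.toJordanDecomposition.negPart)).toLinearMap

theorem signedMonomialLin_apply (ν : SignedMeasure K) (g : C(Fin k → K, ℝ)) :
    signedMonomialLin k ν g = signedMonomial g ν := by
  simp [signedMonomialLin, signedMonomial]

/-- Expand the `k`-th power of ⟨f, ν⁺⟩ - ⟨f, ν⁻⟩ into a sum over sign choices; each term factors
over the product measure. -/
theorem signedMonomial_tensorPow (f : C(K, ℝ)) (k : ℕ) (ν : SignedMeasure K) :
    signedMonomial (tensorPow f k : C(Fin k → K, ℝ)) ν = linPair f ν ^ k := by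
  have h1 : linPair f ν = ∑ b : Bool, (if b then (1 : ℝ) else -1) *
      ∫ x, f x ∂(if b then ν.toJordanDecomposition.posPart
        else ν.toJordanDecomposition.negPart) := by
    simp [linPair, sub_eq_add_neg]
  have h2 := Finset.prod_univ_sum (fun _ : Fin k => (Finset.univ : Finset Bool))
    (fun _ b => (if b then (1 : ℝ) else -1) *
      ∫ x, f x ∂(if b then ν.toJordanDecomposition.posPart
        else ν.toJordanDecomposition.negPart))
  rw [Finset.prod_const, ← h1, Finset.card_univ, Fintype.card_fin] at h2
  rw [h2, signedMonomial]
  simp only [Fintype.piFinset_univ, Finset.prod_mul_distrib]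
  refine Finset.sum_congr rfl fun s _ => ?_
  congr 1
  exact integral_fintype_prod_eq_prod (fun _ => ⇑f)

/-- `signedPoly` as a linear function of the coefficients. -/
def signedPolyLin (K : Type*) [TopologicalSpace K] [CompactSpace K] [T2Space K] [MeasurableSpace K]
    [BorelSpace K] (m : ℕ) : Coeff K m →ₗ[ℝ] (SignedMeasure K → ℝ) :=
  LinearMap.pi fun ν => ∑ k : Fin (m + 1), signedMonomialLin k ν ∘ₗ
    (SymC K k).subtype ∘ₗ LinearMap.proj k

theorem signedPolyLin_apply (g : Coeff K m) : signedPolyLin K m g = signedPoly g := by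
  ext ν
  simp [signedPolyLin, signedPoly, signedMonomialLin_apply]

theorem signedPoly_single_tensorPow (f : C(K, ℝ)) (k : Fin (m + 1)) :
    signedPoly (Pi.single k (tensorPow f k) : Coeff K m) = fun ν => linPair f ν ^ (k : ℕ) := by
  ext ν
  rw [signedPoly, Finset.sum_eq_single k]
  · rw [Pi.single_eq_same, signedMonomial_tensorPow]
  · intro j _ hj
    rw [Pi.single_eq_of_ne hj, ← signedMonomialLin_apply]
    simp
  · simp

theorem linPair_pow_mem_cylPoly {D : Submodule ℝ C(K, ℝ)} {f : C(K, ℝ)} (hf : f ∈ D) (k : ℕ) :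
    (fun ν => linPair f ν ^ k) ∈ cylPoly D :=
  ⟨1, MvPolynomial.X 0 ^ k, fun _ => ⟨f, hf⟩, by simp⟩

theorem signedPoly_mem_span_cylPoly {D : Submodule ℝ C(K, ℝ)} {g : Coeff K m}
    (hg : g ∈ Submodule.pi Set.univ (fun k : Fin (m + 1) => tensorSpan D k)) :
    signedPoly g ∈ Submodule.span ℝ (cylPoly D) := by
  rw [← signedPolyLin_apply, ← Finset.univ_sum_single g, map_sum]
  refine Submodule.sum_mem _ fun k _ => ?_
  have hk : g k ∈ tensorSpan D k := hg k trivial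
  have : tensorSpan D k ≤ (Submodule.span ℝ (cylPoly D)).comap
      (signedPolyLin K m ∘ₗ LinearMap.single ℝ (fun k : Fin (m + 1) => SymC K k) k) := by
    refine Submodule.span_le.mpr ?_
    rintro _ ⟨f, hf, rfl⟩
    refine Submodule.subset_span ?_
    simp only [LinearMap.comp_apply, LinearMap.single_apply]
    rw [signedPolyLin_apply, signedPoly_single_tensorPow]
    exact linPair_pow_mem_cylPoly hf k
  exact this hk

end PolynomialsOfMeasures

/-! ### Approximation of measures on the compactification by measures on `E` -/

section Compactification

variable {E : Type*} [TopologicalSpace E]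

theorem EDelta.isOpenEmbedding_incl : IsOpenEmbedding (EDelta.incl : E → EDelta E) := by
  refine ⟨?_, ?_⟩
  · exact (OnePoint.isOpenEmbedding_coe (X := E)).isEmbedding.codRestrict _
      fun x => subset_closure (mem_range_self x)
  · have : range (EDelta.incl : E → EDelta E) =
        Subtype.val ⁻¹' range ((↑) : E → OnePoint E) := by
      ext ⟨x, hx⟩
      constructor
      · rintro ⟨y, hy⟩; exact ⟨y, congrArg Subtype.val hy⟩
      · rintro ⟨y, hy⟩; exact ⟨y, Subtype.ext hy⟩
    rw [this]
    exact (OnePoint.isOpen_range_coe (X := E)).preimage continuous_subtype_val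

theorem EDelta.denseRange_incl : DenseRange (EDelta.incl : E → EDelta E) := by
  rintro ⟨x, hx⟩
  refine closure_subtype.mpr ?_
  convert! hx using 2
  ext y
  constructor
  · rintro ⟨_, ⟨z, rfl⟩, rfl⟩; exact ⟨z, rfl⟩
  · rintro ⟨z, rfl⟩; exact ⟨_, ⟨z, rfl⟩, rfl⟩

theorem EDelta.eq_of_notMem_range_incl {x y : EDelta E} (hx : x ∉ range (EDelta.incl : E → EDelta E))
    (hy : y ∉ range (EDelta.incl : E → EDelta E)) : x = y := by
  have key : ∀ z : EDelta E, z ∉ range (EDelta.incl : E → EDelta E) → z.1 = OnePoint.infty := by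
    rintro ⟨z, hz⟩ h
    by_contra hne
    obtain ⟨w, hw⟩ := OnePoint.ne_infty_iff_exists.mp hne
    exact h ⟨w, Subtype.ext hw⟩
  exact Subtype.ext ((key x hx).trans (key y hy).symm)

variable [T2Space E] [LocallyCompactSpace E] [MeasurableSpace E] [BorelSpace E]

/-- A finite measure on the compactification is its part on `E` plus at most one atom at the added
point. Moving the atom to points of `E` that approach the added point gives weak convergence. -/
theorem EDelta.dense_range_map_incl :
    DenseRange fun μ : FiniteMeasure E => μ.map (EDelta.incl : E → EDelta E) := by
  intro ν
  have hemb : MeasurableEmbedding (EDelta.incl : E → EDelta E) :=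
    EDelta.isOpenEmbedding_incl.measurableEmbedding
  have hcont : Continuous (EDelta.incl : E → EDelta E) := EDelta.isOpenEmbedding_incl.continuous
  have hfin : IsFiniteMeasure ((ν : Measure (EDelta E)).comap EDelta.incl) :=
    ⟨by rw [hemb.comap_apply]; exact measure_lt_top _ _⟩
  set μ : FiniteMeasure E := ⟨(ν : Measure (EDelta E)).comap EDelta.incl, hfin⟩ with hμ
  have hmap : (μ : Measure E).map EDelta.incl =
      (ν : Measure (EDelta E)).restrict (range EDelta.incl) := hemb.map_comap _
  by_cases hr : range (EDelta.incl : E → EDelta E) = univ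
  · refine subset_closure ⟨μ, ?_⟩
    apply Subtype.ext
    rw [hr, Measure.restrict_univ] at hmap
    exact hmap
  · obtain ⟨x₀, hx₀⟩ := (ne_univ_iff_exists_notMem _).mp hr
    have hcompl : (range (EDelta.incl : E → EDelta E))ᶜ = {x₀} := by
      ext y
      exact ⟨fun hy => EDelta.eq_of_notMem_range_incl hy hx₀, fun hy => by rw [hy]; exact hx₀⟩
    set c : ℝ≥0 := ν {x₀} with hc
    have hint (f : BoundedContinuousFunction (EDelta E) ℝ) :
        ∫ y, f y ∂(ν : Measure (EDelta E)) = ∫ y, f (EDelta.incl y) ∂(μ : Measure E) + c * f x₀ := by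
      rw [← integral_add_compl hemb.measurableSet_range (f.integrable _), ← hmap,
        hemb.integral_map, hcompl, integral_singleton]
      rfl
    -- `E` is dense, so the added point can be approached along the trace of its neighbourhood
    -- filter on `E`.
    have : NeBot (comap EDelta.incl (𝓝 x₀)) :=
      (⟨EDelta.isOpenEmbedding_incl.isInducing, EDelta.denseRange_incl⟩ :
        IsDenseInducing (EDelta.incl : E → EDelta E)).comap_nhds_neBot x₀
    refine mem_closure_of_tendsto (b := comap EDelta.incl (𝓝 x₀))
      (f := fun x : E => (μ + c • (diracProba x).toFiniteMeasure).map EDelta.incl) ?_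
      (Eventually.of_forall fun x => ⟨_, rfl⟩)
    rw [FiniteMeasure.tendsto_iff_forall_integral_tendsto]
    intro f
    have hint' (x : E) : ∫ y, f y
        ∂(((μ + c • (diracProba x).toFiniteMeasure).map EDelta.incl : FiniteMeasure (EDelta E)) :
          Measure (EDelta E)) =
        ∫ y, f (EDelta.incl y) ∂(μ : Measure E) + c * f (EDelta.incl x) := by
      have hint2 (ρ : Measure E) [IsFiniteMeasure ρ] : Integrable (fun y => f (EDelta.incl y)) ρ :=
        (f.compContinuous ⟨_, hcont⟩).integrable ρ
      rw [FiniteMeasure.toMeasure_map, hemb.integral_map, FiniteMeasure.toMeasure_add,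
        integral_add_measure (hint2 _) (hint2 _), FiniteMeasure.toMeasure_smul]
      congr 1
      change ∫ y, f (EDelta.incl y) ∂(c • Measure.dirac x) = _
      rw [integral_smul_nnreal_measure, integral_dirac' (fun y => f (EDelta.incl y)) _ (f.continuous.comp hcont).stronglyMeasurable]
      rfl
    simp only [hint', hint f]
    exact ((f.continuous.tendsto x₀).comp tendsto_comap).const_mul _ |>.const_add _

/-- The polynomial and dual operators are controlled on measures carried by `E` only; this moves
their identities to the whole state space of `X`. -/
theorem eqOn_toSigned_of_eqOn_MPlus {p q : SignedMeasure (EDelta E) → ℝ}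
    (hp : Continuous fun ν : FiniteMeasure (EDelta E) => p (toSigned ν))
    (hq : Continuous fun ν : FiniteMeasure (EDelta E) => q (toSigned ν))
    (h : ∀ ν ∈ MPlus E, p ν = q ν) (ν : FiniteMeasure (EDelta E)) :
    p (toSigned ν) = q (toSigned ν) := by
  refine congrFun (Continuous.ext_on EDelta.dense_range_map_incl hp hq ?_) ν
  rintro _ ⟨μ, rfl⟩
  exact h _ ⟨μ, rfl⟩

end Compactification

/-! ### Degrees and growth -/

section Operators

set_option linter.unusedSectionVars false

variable {K : Type*} [TopologicalSpace K] [CompactSpace K] [T2Space K] [MeasurableSpace K]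
  [BorelSpace K] {k m : ℕ}

theorem linPair_one_toSigned (ν : FiniteMeasure K) :
    linPair (1 : C(K, ℝ)) (toSigned ν) = ν.mass := by
  rw [linPair_toSigned]
  simp [Measure.real, FiniteMeasure.mass, ← FiniteMeasure.ennreal_coeFn_eq_coeFn_toMeasure]

theorem apply_eq_zero_of_coeffDegree_le {g : Coeff K m} (hg : coeffDegree g ≤ k) (j : Fin (m + 1))
    (hj : k < j) : g j = 0 := by
  by_contra h
  have h1 : ((j : ℕ) : WithBot ℕ) ≤ coeffDegree g := by
    unfold coeffDegree
    classical
    exact Finset.le_sup (f := fun k : Fin (m + 1) => ((k : ℕ) : WithBot ℕ))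
      (by simpa using h)
  have h2 := h1.trans hg
  have : (j : ℕ) ≤ k := by exact_mod_cast h2
  omega

/-- The coefficients above the degree vanish, so the growth exponent is `k` however long the
coefficient vector is. -/
theorem abs_poly_le_of_coeffDegree_le {g : Coeff K m} (hg : coeffDegree g ≤ k)
    (ν : FiniteMeasure K) : |poly g ν| ≤ (m + 1) * ‖g‖ * (1 + (ν.mass : ℝ) ^ k) := by
  calc |poly g ν| ≤ ∑ k : Fin (m + 1), |posMonomial (g k : C(Fin k → K, ℝ)) ν| :=
        Finset.abs_sum_le_sum_abs _ _
    _ ≤ ∑ _j : Fin (m + 1), ‖g‖ * (1 + (ν.mass : ℝ) ^ k) := by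
        refine Finset.sum_le_sum fun j _ => (abs_posMonomial_le _ ν).trans ?_
        have h1 : ‖(g j : C(Fin j → K, ℝ))‖ ≤ ‖g‖ := norm_le_pi_norm g j
        rcases lt_or_ge k (j : ℕ) with hj | hj
        · rw [apply_eq_zero_of_coeffDegree_le hg j hj]
          simp only [ZeroMemClass.coe_zero, norm_zero, zero_mul]
          positivity
        · have h2 := pow_le_one_add_pow (NNReal.coe_nonneg ν.mass) hj
          gcongr
    _ = _ := by simp; ring

theorem coeffDegree_le (g : Coeff K m) : coeffDegree g ≤ m :=
  Finset.sup_le fun k _ => by exact_mod_cast Nat.lt_succ_iff.mp k.2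

/-- Degrees are well ordered, so the infimum defining `polyDegree` is attained. No uniqueness of
coefficients is needed. -/
theorem exists_coeffDegree_le_of_polyDegree_le {q : SignedMeasure K → ℝ} (hq : q ∈ polynomials K)
    {d : WithBot ℕ} (hd : polyDegree q ≤ d) :
    ∃ (m : ℕ) (g : Coeff K m), q = signedPoly g ∧ coeffDegree g ≤ d := by
  obtain ⟨m, g, hg⟩ := hq
  have hmem : polyDegree q ∈ {d | ∃ (m : ℕ) (g : Coeff K m), q = signedPoly g ∧ d = coeffDegree g} :=
    csInf_mem ⟨_, m, g, hg, rfl⟩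
  obtain ⟨m', g', h1, h2⟩ := hmem
  exact ⟨m', g', h1, h2 ▸ hd⟩

theorem polyDegree_signedPoly_le (g : Coeff K m) : polyDegree (signedPoly g) ≤ m :=
  by
  refine le_trans (csInf_le (OrderBot.bddBelow _) ?_) (coeffDegree_le g)
  exact ⟨m, g, rfl, rfl⟩

theorem continuous_toSigned_of_mem_polynomials {q : SignedMeasure K → ℝ} (hq : q ∈ polynomials K) :
    Continuous fun ν : FiniteMeasure K => q (toSigned ν) := by
  obtain ⟨m, g, rfl⟩ := hq
  simp only [signedPoly_toSigned]
  exact continuous_poly g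

variable {D : Submodule ℝ C(K, ℝ)} {S : Set (SignedMeasure K)} {L : cylDomain D →ₗ[ℝ] measurableMaps K}

/-- The hypothesis speaks of single elements of `cylPoly D`; linearity of `L` carries continuity
over to the span. -/
theorem IsPolynomialOperator.continuous_toSigned (hL : IsPolynomialOperator D S L) (p : cylDomain D)
    (hp : (p : SignedMeasure K → ℝ) ∈ Submodule.span ℝ (cylPoly D)) :
    Continuous fun ν : FiniteMeasure K => (L p : SignedMeasure K → ℝ) (toSigned ν) := by
  have hle : Submodule.span ℝ (cylPoly D) ≤ cylDomain D := Submodule.span_mono subset_union_left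
  have key : ∀ x (hx : x ∈ Submodule.span ℝ (cylPoly D)), Continuous fun ν : FiniteMeasure K =>
      (L ⟨x, hle hx⟩ : SignedMeasure K → ℝ) (toSigned ν) := by
    intro x hx
    induction hx using Submodule.span_induction with
    | mem x h => exact continuous_toSigned_of_mem_polynomials (hL _ h).1
    | zero =>
      have : (⟨0, hle (zero_mem _)⟩ : cylDomain D) = 0 := rfl
      rw [this, map_zero]
      exact continuous_const
    | add x y hx hy h1 h2 =>
      have : (⟨x + y, hle (add_mem hx hy)⟩ : cylDomain D) = ⟨x, hle hx⟩ + ⟨y, hle hy⟩ := rfl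
      rw [this, map_add]
      exact h1.add h2
    | smul a x hx h1 =>
      have : (⟨a • x, hle (Submodule.smul_mem _ a hx)⟩ : cylDomain D) = a • ⟨x, hle hx⟩ := rfl
      rw [this, map_smul]
      exact h1.const_smul a
  exact key p hp

/-- The monomial `ν ↦ ⟨1, ν⟩^k` as an element of the domain. -/
def massPow {D : Submodule ℝ C(K, ℝ)} (hD1 : (1 : C(K, ℝ)) ∈ D) (k : ℕ) : cylDomain D :=
  ⟨fun ν => linPair (1 : C(K, ℝ)) ν ^ k,
    Submodule.subset_span (Or.inl (linPair_pow_mem_cylPoly hD1 k))⟩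

theorem massPow_toSigned (hD1 : (1 : C(K, ℝ)) ∈ D) (k : ℕ) (ν : FiniteMeasure K) :
    (massPow hD1 k : SignedMeasure K → ℝ) (toSigned ν) = (ν.mass : ℝ) ^ k := by
  simp only [massPow, linPair_one_toSigned]

end Operators

/-! ### Polynomial and dual operators on all finite measures of the compactification -/

section DualOperators

variable {E : Type*} [TopologicalSpace E] [T2Space E] [LocallyCompactSpace E] [MeasurableSpace E]
  [BorelSpace E] {D : Submodule ℝ C(EDelta E, ℝ)}
  {L : cylDomain D →ₗ[ℝ] measurableMaps (EDelta E)}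

/-- This is where the degree condition on `L` enters: it bounds the drift of a power of the mass by
the same power, as Gronwall's inequality requires. -/
theorem IsPolynomialOperator.exists_abs_massPow_le (hL : IsPolynomialOperator D (MPlus E) L)
    (hD1 : (1 : C(EDelta E, ℝ)) ∈ D) (k : ℕ) :
    ∃ C : ℝ, 0 ≤ C ∧ ∀ ν : FiniteMeasure (EDelta E),
      |(L (massPow hD1 k) : SignedMeasure (EDelta E) → ℝ) (toSigned ν)| ≤
        C * (1 + (ν.mass : ℝ) ^ k) := by
  have hp := linPair_pow_mem_cylPoly hD1 k
  obtain ⟨h1, q, hq, heq, hdeg⟩ := hL (massPow hD1 k) hp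
  have hdeg' : polyDegree q ≤ (k : WithBot ℕ) := by
    refine hdeg.trans ?_
    have := polyDegree_signedPoly_le
      (Pi.single (Fin.last k) (tensorPow (1 : C(EDelta E, ℝ)) (Fin.last k)) : Coeff (EDelta E) k)
    rwa [signedPoly_single_tensorPow] at this
  obtain ⟨m, g, rfl, hg⟩ := exists_coeffDegree_le_of_polyDegree_le hq hdeg'
  refine ⟨(m + 1) * ‖g‖, by positivity, fun ν => ?_⟩
  rw [← eqOn_toSigned_of_eqOn_MPlus (continuous_toSigned_of_mem_polynomials hq)
    (continuous_toSigned_of_mem_polynomials h1) heq ν, signedPoly_toSigned]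
  exact abs_poly_le_of_coeffDegree_le hg ν

theorem IsDualOperator.apply_toSigned (hL : IsPolynomialOperator D (MPlus E) L) {m : ℕ}
    {A : Coeff (EDelta E) m →ₗ.[ℝ] Coeff (EDelta E) m} (hA : IsDualOperator D (MPlus E) L m A)
    (g : A.domain) : ∃ p : cylDomain D,
      (p : SignedMeasure (EDelta E) → ℝ) ∈ Submodule.span ℝ (cylPoly D) ∧
      (∀ ν : FiniteMeasure (EDelta E), (p : SignedMeasure (EDelta E) → ℝ) (toSigned ν) =
        poly (g : Coeff (EDelta E) m) ν) ∧
      ∀ ν : FiniteMeasure (EDelta E), (L p : SignedMeasure (EDelta E) → ℝ) (toSigned ν) =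
        poly (A g) ν := by
  have hmem : signedPoly (g : Coeff (EDelta E) m) ∈ Submodule.span ℝ (cylPoly D) :=
    signedPoly_mem_span_cylPoly (hA.1.le g.2)
  refine ⟨⟨signedPoly (g : Coeff (EDelta E) m),
    Submodule.span_mono subset_union_left hmem⟩, hmem, signedPoly_toSigned _, fun ν => ?_⟩
  rw [eqOn_toSigned_of_eqOn_MPlus (hL.continuous_toSigned _ hmem)
    (continuous_toSigned_of_mem_polynomials ⟨m, A g, rfl⟩) (hA.2 g _ rfl) ν, signedPoly_toSigned]

end DualOperators

/-! ### Uniform bounds from Baire's theorem and Lagrange interpolation -/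

section UniformBoundedness

open scoped BoundedContinuousFunction

set_option linter.unusedSectionVars false

variable {K : Type*} [TopologicalSpace K] [CompactSpace K] [T2Space K] [MeasurableSpace K]
  [BorelSpace K] {m : ℕ}

/-- The positive functionals on `C(K)`. -/
def positiveFunctionals (K : Type*) [TopologicalSpace K] : Set ((K →ᵇ ℝ) →L[ℝ] ℝ) :=
  {Λ | ∀ f : K →ᵇ ℝ, 0 ≤ f → 0 ≤ Λ f}

/-- Baire's theorem for the closed cone of functionals that are nonnegative on a given set. -/
theorem exists_ball_subset_of_iUnion_eq_univ {V : Type*} [NormedAddCommGroup V] [NormedSpace ℝ V]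
    {P : Set V} {s : Set (V →L[ℝ] ℝ)} (hs : s = {Λ | ∀ v ∈ P, 0 ≤ Λ v}) {f : ℕ → Set s}
    (hc : ∀ (N : ℕ) (Λ : ℕ → s) (Λ' : s), (∀ n, Λ n ∈ f N) →
      Tendsto (fun n => ‖(Λ n : V →L[ℝ] ℝ) - Λ'‖) atTop (𝓝 0) → Λ' ∈ f N)
    (hU : ⋃ N, f N = univ) :
    ∃ (N : ℕ) (Λ₀ : s) (r : ℝ), 0 < r ∧ ∀ Λ : s, ‖(Λ : V →L[ℝ] ℝ) - Λ₀‖ < r → Λ ∈ f N := by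
  have hcl : IsClosed s := by
    rw [hs]
    simp only [ofPred_forall]
    refine isClosed_iInter fun v => isClosed_iInter fun _ => ?_
    exact isClosed_le continuous_const (ContinuousLinearMap.apply ℝ ℝ v).continuous
  have : CompleteSpace s := hcl.completeSpace_coe
  have : Nonempty s := ⟨⟨0, by rw [hs]; exact fun _ _ => le_rfl⟩⟩
  obtain ⟨N, Λ₀, hΛ₀⟩ := nonempty_interior_of_iUnion_of_closed (fun N => by
    refine isSeqClosed_iff_isClosed.mp fun Λ Λ' hΛ hlim => hc N Λ Λ' hΛ ?_
    rw [tendsto_iff_dist_tendsto_zero] at hlim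
    simpa only [Subtype.dist_eq, dist_eq_norm] using hlim) hU
  obtain ⟨r, hr, hball⟩ := Metric.mem_nhds_iff.mp (mem_interior_iff_mem_nhds.mp hΛ₀)
  refine ⟨N, Λ₀, r, hr, fun Λ hΛ => hball (Metric.mem_ball.mpr ?_)⟩
  rwa [Subtype.dist_eq, dist_eq_norm]

/-- Integration against a finite measure. -/
def integralFunctional (ν : FiniteMeasure K) : (K →ᵇ ℝ) →L[ℝ] ℝ :=
  LinearMap.mkContinuous
    { toFun f := ∫ x, f x ∂(ν : Measure K)
      map_add' f g := integral_add (f.integrable _) (g.integrable _)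
      map_smul' c f := integral_const_mul c _ } ((ν : Measure K).real univ) fun f => by
    have := norm_integral_le_of_norm_le_const (μ := (ν : Measure K))
      (ae_of_all _ fun x => f.norm_coe_le_norm x)
    simpa [mul_comm] using this

theorem norm_integralFunctional_le (ν : FiniteMeasure K) : ‖integralFunctional ν‖ ≤ ν.mass :=
  LinearMap.mkContinuous_norm_le _ (by positivity) _

theorem integralFunctional_mem (ν : FiniteMeasure K) :
    integralFunctional ν ∈ positiveFunctionals K :=
  fun _ hf => integral_nonneg hf

/-- Riesz–Markov–Kakutani. It identifies finite measures with a norm-closed cone in a Banach dual,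
which is complete and so open to Baire's theorem. -/
theorem exists_integral_eq_of_mem_positiveFunctionals {Λ : (K →ᵇ ℝ) →L[ℝ] ℝ}
    (hΛ : Λ ∈ positiveFunctionals K) :
    ∃ ν : FiniteMeasure K, ∀ f : K →ᵇ ℝ, ∫ x, f x ∂(ν : Measure K) = Λ f := by
  let e (f : CompactlySupportedContinuousMap K ℝ) : K →ᵇ ℝ :=
    BoundedContinuousFunction.mkOfCompact f.toContinuousMap
  let Λ' : CompactlySupportedContinuousMap K ℝ →ₚ[ℝ] ℝ := PositiveLinearMap.mk₀
    { toFun := fun f => Λ (e f)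
      map_add' := fun f g => map_add Λ (e f) (e g)
      map_smul' := fun c f => map_smul Λ c (e f) } fun f hf => hΛ _ hf
  refine ⟨⟨RealRMK.rieszMeasure Λ', inferInstance⟩, fun f => ?_⟩
  exact RealRMK.integral_rieszMeasure Λ'
    (CompactlySupportedContinuousMap.continuousMapEquiv f.toContinuousMap)

variable {α : Type*} [MeasurableSpace α] {ρ : Measure α} {H : α → Coeff K m}

/-- The interpolation weights do not depend on the family `H`, so bounds on its integral at the
nodes pass to every point of the line. -/
theorem lintegral_enorm_poly_le_of_lagrange {x : ℝ} {v : Fin (m + 1) → ℝ}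
    (hv : Function.Injective v) (μ : FiniteMeasure K) (μ' : Fin (m + 1) → FiniteMeasure K)
    (h : ∀ f : C(K, ℝ), ∃ a b : ℝ, ∫ y, f y ∂(μ : Measure K) = a + x * b ∧
      ∀ j, ∫ y, f y ∂(μ' j : Measure K) = a + v j * b)
    (hH : ∀ ν : FiniteMeasure K, AEStronglyMeasurable (fun s => poly (H s) ν) ρ) :
    ∫⁻ s, ‖poly (H s) μ‖ₑ ∂ρ ≤ ∑ j, ‖(Lagrange.basis Finset.univ v j).eval x‖ₑ *
      ∫⁻ s, ‖poly (H s) (μ' j)‖ₑ ∂ρ := by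
  calc ∫⁻ s, ‖poly (H s) μ‖ₑ ∂ρ
      ≤ ∫⁻ s, ∑ j, ‖(Lagrange.basis Finset.univ v j).eval x‖ₑ * ‖poly (H s) (μ' j)‖ₑ ∂ρ := by
        refine lintegral_mono fun s => ?_
        simp only [poly_eq_sum_lagrange (H s) hv μ μ' h]
        refine (enorm_sum_le _ _).trans (Finset.sum_le_sum fun j _ => ?_)
        rw [enorm_mul]
    _ = _ := by
        rw [lintegral_finsetSum' _ fun j _ => (hH (μ' j)).enorm.const_mul _]
        exact Finset.sum_congr rfl fun j _ => lintegral_const_mul'' _ (hH (μ' j)).enorm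

/-- A family of polynomials that is integrable at every measure is uniformly integrable over the
measures of mass at most one. -/
theorem exists_lintegral_enorm_poly_le_of_mass_le_one
    (hH : ∀ ν : FiniteMeasure K, Integrable (fun s => poly (H s) ν) ρ) :
    ∃ C : ℝ≥0∞, C ≠ ∞ ∧ ∀ ν : FiniteMeasure K, ν.mass ≤ 1 →
      ∫⁻ s, ‖poly (H s) ν‖ₑ ∂ρ ≤ C := by
  choose M hM using fun Λ : positiveFunctionals K =>
    exists_integral_eq_of_mem_positiveFunctionals Λ.2
  have hMlim (Λ : ℕ → positiveFunctionals K) (Λ' : positiveFunctionals K)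
      (hlim : Tendsto (fun n => ‖(Λ n : (K →ᵇ ℝ) →L[ℝ] ℝ) - Λ'‖) atTop (𝓝 0)) :
      Tendsto (fun n => M (Λ n)) atTop (𝓝 (M Λ')) := by
    refine FiniteMeasure.tendsto_iff_forall_integral_tendsto.mpr fun f => ?_
    simp only [hM]
    rw [tendsto_iff_norm_sub_tendsto_zero]
    refine squeeze_zero (fun _ => norm_nonneg _) (fun n => ?_)
      (by simpa using hlim.mul_const ‖f‖)
    exact ((Λ n : (K →ᵇ ℝ) →L[ℝ] ℝ) - Λ').le_opNorm f
  -- The functionals with integral at most `N` form a closed set: norm convergence implies weak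
  -- convergence of the measures, polynomials are continuous, and Fatou applies. Integrability at
  -- every measure makes these sets cover the cone.
  obtain ⟨N, Λ₀, r, hr, hball⟩ := exists_ball_subset_of_iUnion_eq_univ (P := {f : K →ᵇ ℝ | 0 ≤ f})
    (s := positiveFunctionals K) rfl
    (f := fun N : ℕ => {Λ : positiveFunctionals K | ∫⁻ s, ‖poly (H s) (M Λ)‖ₑ ∂ρ ≤ N}) (by
      intro N Λ Λ' hΛ hlim
      have hpt (s : α) : ‖poly (H s) (M Λ')‖ₑ = liminf (fun n => ‖poly (H s) (M (Λ n))‖ₑ) atTop :=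
        ((continuous_poly (H s)).enorm.tendsto _ |>.comp (hMlim Λ Λ' hlim)).liminf_eq.symm
      simp only [mem_ofPred_eq, hpt]
      refine (lintegral_liminf_le' fun n => (hH _).1.enorm).trans ?_
      exact liminf_le_of_frequently_le' (Frequently.of_forall hΛ)) (by
      refine eq_univ_of_forall fun Λ => mem_iUnion.mpr ?_
      obtain ⟨N, hN⟩ := ENNReal.exists_nat_gt (hH (M Λ)).2.ne
      exact ⟨N, hN.le⟩)
  -- For parameters in [0, δ), the segment from `Λ₀` towards any ν of mass at most one stays in the
  -- ball of radius `r`; `δ ≤ 1` keeps its points positive.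
  set δ : ℝ := min 1 (r / (1 + ‖(Λ₀ : (K →ᵇ ℝ) →L[ℝ] ℝ)‖)) with hδ
  have hδ0 : 0 < δ := lt_min one_pos (by positivity)
  set v : Fin (m + 1) → ℝ := fun j => δ * (j / (m + 1)) with hv
  have hvinj : Function.Injective v := by
    intro i j hij
    have h1 : ((i : ℕ) : ℝ) = (j : ℕ) := by
      simp only [hv] at hij
      have h2 := mul_left_cancel₀ hδ0.ne' hij
      field_simp at h2
      exact h2
    exact Fin.ext (by exact_mod_cast h1)
  have hfrac (j : Fin (m + 1)) : ((j : ℕ) : ℝ) / (m + 1) < 1 := by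
    rw [div_lt_one (by positivity)]
    exact_mod_cast j.2
  have hv0 (j) : 0 ≤ v j := by positivity
  have hv1 (j) : v j < δ := by
    simpa using mul_lt_mul_of_pos_left (hfrac j) hδ0
  refine ⟨∑ j, ‖(Lagrange.basis Finset.univ v j).eval 1‖ₑ * N, ?_, fun ν hν => ?_⟩
  · exact (ENNReal.sum_lt_top.mpr fun j _ => ENNReal.mul_lt_top enorm_lt_top (by simp)).ne
  have hmem (j) : (1 - v j) • (Λ₀ : (K →ᵇ ℝ) →L[ℝ] ℝ) + v j • integralFunctional ν ∈
      positiveFunctionals K := by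
    intro f hf
    have h1 := Λ₀.2 f hf
    have h2 := integralFunctional_mem ν f hf
    have h3 : v j ≤ 1 := (hv1 j).le.trans (min_le_left _ _)
    simp only [add_apply, smul_apply, smul_eq_mul]
    have := hv0 j
    have : 0 ≤ 1 - v j := by linarith
    positivity
  have hint (j) : ∫⁻ s, ‖poly (H s) (M ⟨_, hmem j⟩)‖ₑ ∂ρ ≤ N := by
    refine hball ⟨_, hmem j⟩ ?_
    have h1 : (1 - v j) • (Λ₀ : (K →ᵇ ℝ) →L[ℝ] ℝ) + v j • integralFunctional ν - Λ₀ =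
        v j • (integralFunctional ν - Λ₀) := by
      module
    rw [h1, norm_smul, Real.norm_of_nonneg (hv0 j)]
    have h2 : ‖integralFunctional ν - (Λ₀ : (K →ᵇ ℝ) →L[ℝ] ℝ)‖ ≤
        1 + ‖(Λ₀ : (K →ᵇ ℝ) →L[ℝ] ℝ)‖ := by
      have hν1 : ‖integralFunctional ν‖ ≤ 1 :=
        (norm_integralFunctional_le ν).trans (by exact_mod_cast hν)
      have h4 := norm_sub_le (integralFunctional ν) (Λ₀ : (K →ᵇ ℝ) →L[ℝ] ℝ)
      linarith
    have h3 : 0 < 1 + ‖(Λ₀ : (K →ᵇ ℝ) →L[ℝ] ℝ)‖ := by positivity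
    calc _ ≤ v j * (1 + ‖(Λ₀ : (K →ᵇ ℝ) →L[ℝ] ℝ)‖) := mul_le_mul_of_nonneg_left h2 (hv0 j)
      _ < δ * (1 + ‖(Λ₀ : (K →ᵇ ℝ) →L[ℝ] ℝ)‖) := by gcongr; exact hv1 j
      _ ≤ r / (1 + ‖(Λ₀ : (K →ᵇ ℝ) →L[ℝ] ℝ)‖) * (1 + ‖(Λ₀ : (K →ᵇ ℝ) →L[ℝ] ℝ)‖) := by
        gcongr; exact min_le_right _ _
      _ = r := by field_simp
  -- Extrapolate from nodes inside the ball to the parameter 1, which is ν itself. The weights are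
  -- independent of ν.
  refine (lintegral_enorm_poly_le_of_lagrange (x := 1) hvinj ν (fun j => M ⟨_, hmem j⟩)
    (fun f => ⟨Λ₀.1 (.mkOfCompact f), integralFunctional ν (.mkOfCompact f) - Λ₀.1 (.mkOfCompact f),
      ?_, fun j => ?_⟩) fun ν => (hH ν).1).trans ?_
  · rw [one_mul, add_sub_cancel]; rfl
  · refine (hM _ (.mkOfCompact f)).trans ?_
    simp only [add_apply, smul_apply, smul_eq_mul]
    ring
  · exact Finset.sum_le_sum fun j _ => by gcongr; exact hint j

theorem exists_abs_eval_le_of_natDegree_le {p : Polynomial ℝ} (hp : p.natDegree ≤ m) :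
    ∃ C : ℝ, 0 ≤ C ∧ ∀ x : ℝ, 0 ≤ x → |p.eval x| ≤ C * (1 + x ^ m) := by
  refine ⟨∑ i ∈ Finset.range (m + 1), |p.coeff i|, by positivity, fun x hx => ?_⟩
  rw [Polynomial.eval_eq_sum_range' (Nat.lt_succ_of_le hp), Finset.sum_mul]
  refine (Finset.abs_sum_le_sum_abs _ _).trans (Finset.sum_le_sum fun i hi => ?_)
  rw [abs_mul, abs_of_nonneg (pow_nonneg hx i)]
  gcongr
  exact pow_le_one_add_pow hx (Nat.lt_succ_iff.mp (Finset.mem_range.mp hi))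

/-- A family of polynomials of degree `m` that is integrable at every measure is integrable with a
bound that grows like the `m`-th power of the mass. -/
theorem exists_lintegral_enorm_poly_le
    (hH : ∀ ν : FiniteMeasure K, Integrable (fun s => poly (H s) ν) ρ) :
    ∃ C : ℝ, 0 ≤ C ∧ ∀ ν : FiniteMeasure K,
      ∫⁻ s, ‖poly (H s) ν‖ₑ ∂ρ ≤ ENNReal.ofReal (C * (1 + (ν.mass : ℝ) ^ m)) := by
  obtain ⟨C, hC, hle⟩ := exists_lintegral_enorm_poly_le_of_mass_le_one hH
  set v : Fin (m + 1) → ℝ≥0 := fun j => j / (m + 1) with hv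
  have hvinj : Function.Injective fun j => (v j : ℝ) := by
    intro i j hij
    have h1 : ((i : ℕ) : ℝ) = (j : ℕ) := by
      simp only [hv] at hij
      push_cast at hij
      field_simp at hij
      exact hij
    exact Fin.ext (by exact_mod_cast h1)
  have hv1 (j) : v j ≤ 1 := by
    rw [hv]
    refine div_le_one_of_le₀ ?_ (by positivity)
    exact_mod_cast j.2.le
  choose B hB0 hB using fun j => exists_abs_eval_le_of_natDegree_le
    (p := Lagrange.basis Finset.univ (fun j => (v j : ℝ)) j) (m := m)
    (by rw [Lagrange.natDegree_basis hvinj.injOn (Finset.mem_univ j)]; simp)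
  refine ⟨C.toReal + (∑ j, B j) * C.toReal, by have := Finset.sum_nonneg fun j (_ : j ∈ Finset.univ) => hB0 j; positivity, fun ν => ?_⟩
  have hBsum : 0 ≤ ∑ j, B j := Finset.sum_nonneg fun j _ => hB0 j
  have hCr : C = ENNReal.ofReal C.toReal := (ENNReal.ofReal_toReal hC).symm
  have hpow : 0 ≤ (ν.mass : ℝ) ^ m := by positivity
  have hCr0 : 0 ≤ C.toReal := ENNReal.toReal_nonneg
  rcases le_or_gt ν.mass 1 with h1 | h1
  · refine (hle ν h1).trans ?_
    rw [hCr, ENNReal.toReal_ofReal hCr0]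
    refine ENNReal.ofReal_le_ofReal ?_
    have : 0 ≤ (∑ j, B j) * C.toReal := by positivity
    nlinarith
  · have hm0 : ν.mass ≠ 0 := (one_pos.trans h1).ne'
    have hmass (j) : ((v j * ν.mass⁻¹) • ν).mass ≤ 1 := by
      have : ((v j * ν.mass⁻¹) • ν).mass = v j * ν.mass⁻¹ * ν.mass := by
        simp [FiniteMeasure.mass, mul_assoc]
      rw [this, mul_assoc, inv_mul_cancel₀ hm0, mul_one]
      exact hv1 j
    -- On the ray through ν normalised to mass one, the nodes have mass at most one and ν sits at
    -- parameter `ν.mass`. The basis polynomials have degree `m`, whence the growth rate.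
    refine (lintegral_enorm_poly_le_of_lagrange (x := ν.mass) hvinj ν
      (fun j => (v j * ν.mass⁻¹) • ν) (fun f => ⟨0, (ν.mass : ℝ)⁻¹ * ∫ y, f y ∂(ν : Measure K),
        ?_, fun j => ?_⟩) fun ν => (hH ν).1).trans ?_
    · rw [zero_add, mul_inv_cancel_left₀ (by exact_mod_cast hm0)]
    · rw [FiniteMeasure.toMeasure_smul, integral_smul_nnreal_measure, zero_add, ← mul_assoc]
      rfl
    · calc _ ≤ ∑ j, ENNReal.ofReal (B j * (1 + (ν.mass : ℝ) ^ m)) * ENNReal.ofReal C.toReal := by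
            refine Finset.sum_le_sum fun j _ => ?_
            gcongr
            · rw [Real.enorm_eq_ofReal_abs]
              exact ENNReal.ofReal_le_ofReal (hB j _ (by positivity))
            · rw [← hCr]; exact hle _ (hmass j)
        _ = ENNReal.ofReal ((∑ j, B j) * C.toReal * (1 + (ν.mass : ℝ) ^ m)) := by
            rw [← Finset.sum_mul, ← ENNReal.ofReal_sum_of_nonneg
              fun j _ => by have := hB0 j; positivity, ← ENNReal.ofReal_mul (Finset.sum_nonneg
              fun j _ => by have := hB0 j; positivity), ← Finset.sum_mul]
            congr 1; ring
        _ ≤ _ := by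
            refine ENNReal.ofReal_le_ofReal ?_
            nlinarith

end UniformBoundedness

/-! ### Measurability and boundedness of right-continuous paths -/

section RightContinuity

/-- The right end point of the dyadic-type interval of length `1 / (n + 1)` containing `x`. -/
def gridPoint (n : ℕ) (x : ℝ≥0) : ℝ≥0 := ((⌊(n + 1) * x⌋₊ : ℝ≥0) + 1) / (n + 1)

theorem tendsto_gridPoint (x : ℝ≥0) :
    Tendsto (fun n => gridPoint n x) atTop (𝓝[Ici x] x) := by
  have hlt (n : ℕ) : x ≤ gridPoint n x := by
    rw [gridPoint, le_div_iff₀ (by positivity), mul_comm]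
    exact (Nat.lt_floor_add_one _).le
  refine tendsto_nhdsWithin_of_tendsto_nhds_of_eventually_within _ ?_ (Eventually.of_forall hlt)
  have hle (n : ℕ) : gridPoint n x ≤ x + 1 / ((n : ℝ≥0) + 1) := by
    rw [gridPoint, add_div]
    gcongr
    rw [div_le_iff₀ (by positivity), mul_comm]
    exact Nat.floor_le (by positivity)
  refine tendsto_of_tendsto_of_tendsto_of_le_of_le tendsto_const_nhds ?_ hlt hle
  have := (tendsto_one_div_add_atTop_nhds_zero_nat (𝕜 := ℝ≥0)).const_add x
  simpa using this

theorem measurable_of_rightContinuous {y : ℝ≥0 → ℝ}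
    (hy : ∀ t, ContinuousWithinAt y (Ici t) t) : Measurable y := by
  refine measurable_of_tendsto_metrizable (f := fun n t => y (gridPoint n t)) (fun n => ?_)
    (tendsto_pi_nhds.mpr fun t => (hy t).tendsto.comp (tendsto_gridPoint t))
  exact (measurable_from_top (f := fun k : ℕ => y (((k : ℝ≥0) + 1) / (n + 1)))).comp
    (Nat.measurable_floor.comp (measurable_id.const_mul _))

variable {α Ω : Type*} [MeasurableSpace α] [MeasurableSpace Ω]

theorem aestronglyMeasurable_comp_nat {ρ : Measure α} {P : Measure Ω} [SFinite P]
    {κ : α → ℕ} (hκ : Measurable κ) {Z : ℕ → Ω → ℝ} (hZ : ∀ k, AEStronglyMeasurable (Z k) P) :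
    AEStronglyMeasurable (fun p : α × Ω => Z (κ p.1) p.2) (ρ.prod P) := by
  have hmeas : Measurable fun p : ℕ × Ω => (hZ p.1).mk (Z p.1) p.2 :=
    measurable_from_prod_countable_right fun k => (hZ k).stronglyMeasurable_mk.measurable
  refine ⟨fun p => (hZ (κ p.1)).mk (Z (κ p.1)) p.2, (hmeas.comp
    ((hκ.comp measurable_fst).prodMk measurable_snd)).stronglyMeasurable, ?_⟩
  have h1 : ∀ᵐ ω ∂P, ∀ k, Z k ω = (hZ k).mk (Z k) ω := ae_all_iff.mpr fun k => (hZ k).ae_eq_mk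
  filter_upwards [Measure.quasiMeasurePreserving_snd.ae h1] with p hp using hp _

/-- Sampling at grid points to the right makes time enter through a natural number, so only
countably many random variables are involved; right-continuity identifies the limit. -/
theorem aestronglyMeasurable_uncurry_of_rightContinuous {ρ : Measure ℝ} [SFinite ρ]
    {P : Measure Ω} [SFinite P] {Y : ℝ≥0 → Ω → ℝ} (hY : ∀ t, AEStronglyMeasurable (Y t) P)
    (hc : ∀ᵐ ω ∂P, ∀ t, ContinuousWithinAt (fun r => Y r ω) (Ici t) t) :
    AEStronglyMeasurable (fun p : ℝ × Ω => Y p.1.toNNReal p.2) (ρ.prod P) := by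
  refine aestronglyMeasurable_of_tendsto_ae atTop
    (f := fun n p => Y (gridPoint n p.1.toNNReal) p.2) (fun n => ?_) ?_
  · exact aestronglyMeasurable_comp_nat
      (Z := fun k => Y (((k : ℝ≥0) + 1) / (n + 1)))
      (κ := fun s : ℝ => ⌊((n : ℝ≥0) + 1) * s.toNNReal⌋₊)
      (Nat.measurable_floor.comp (measurable_real_toNNReal.const_mul _)) fun k => hY _
  · filter_upwards [Measure.quasiMeasurePreserving_snd.ae hc] with p hp
    exact (hp _).tendsto.comp (tendsto_gridPoint _)

theorem IsCadlag.comp {S S' : Type*} [TopologicalSpace S] [TopologicalSpace S'] {x : ℝ≥0 → S}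
    (hx : IsCadlag x) {f : S → S'} (hf : Continuous f) : IsCadlag fun t => f (x t) := fun t =>
  ⟨hf.continuousAt.comp_continuousWithinAt (hx t).1,
    let ⟨l, hl⟩ := (hx t).2; ⟨f l, (hf.tendsto l).comp hl⟩⟩

/-- The left limit and right-continuity bound the path near each time; compactness of `[0, t]` does
the rest. -/
theorem IsCadlag.exists_abs_le {y : ℝ≥0 → ℝ} (hy : IsCadlag y) (t : ℝ≥0) :
    ∃ C, ∀ r ≤ t, |y r| ≤ C := by
  have := (isCompact_Icc (a := (0 : ℝ≥0)) (b := t)).induction_on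
    (p := fun s => ∃ C, ∀ r ∈ s, |y r| ≤ C) ⟨0, by simp⟩
    (fun s s' hs ⟨C, hC⟩ => ⟨C, fun r hr => hC r (hs hr)⟩)
    (fun s s' ⟨C, hC⟩ ⟨C', hC'⟩ => ⟨max C C', fun r hr => hr.elim
      (fun h => (hC r h).trans (le_max_left _ _)) fun h => (hC' r h).trans (le_max_right _ _)⟩)
    (fun x _ => by
      obtain ⟨l, hl⟩ := (hy x).2
      have h1 : ∀ᶠ r in 𝓝[<] x, |y r| ≤ |l| + 1 :=
        (hl.abs.eventually_lt_const (lt_add_one _)).mono fun _ h => h.le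
      have h2 : ∀ᶠ r in 𝓝[≥] x, |y r| ≤ |y x| + 1 :=
        ((hy x).1.tendsto.abs.eventually_lt_const (lt_add_one _)).mono fun _ h => h.le
      have h3 : {r | |y r| ≤ max (|l| + 1) (|y x| + 1)} ∈ 𝓝 x := by
        rw [← nhdsLT_sup_nhdsGE x]
        exact ⟨h1.mono fun _ h => h.trans (le_max_left _ _),
          h2.mono fun _ h => h.trans (le_max_right _ _)⟩
      exact ⟨_, mem_nhdsWithin_of_mem_nhds h3, _, fun r hr => hr⟩)
  obtain ⟨C, hC⟩ := this
  exact ⟨C, fun r hr => hC r ⟨zero_le, hr⟩⟩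

theorem IsCadlag.intervalIntegrable {y : ℝ≥0 → ℝ} (hy : IsCadlag y) (a b : ℝ) :
    IntervalIntegrable (fun s : ℝ => y s.toNNReal) volume a b := by
  obtain ⟨C, hC⟩ := hy.exists_abs_le (max a b).toNNReal
  have hm : Measurable fun s : ℝ => y s.toNNReal :=
    (measurable_of_rightContinuous fun t => (hy t).1).comp measurable_real_toNNReal
  rw [intervalIntegrable_iff]
  refine Measure.integrableOn_of_bounded (M := C) (by simp) hm.aestronglyMeasurable ?_
  filter_upwards [ae_restrict_mem measurableSet_uIoc] with s hs
  exact hC _ (Real.toNNReal_le_toNNReal hs.2)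

end RightContinuity

/-! ### Fubini on a triangle and Gronwall's inequality -/

section Triangle

/-- Fubini's theorem on the triangle `0 < r ≤ s ≤ t`. -/
theorem intervalIntegral_triangle_swap {f : ℝ → ℝ → ℝ} {t : ℝ} (ht : 0 ≤ t)
    (hf : Integrable (fun p : ℝ × ℝ => f p.1 p.2)
      ((volume.restrict (Ioc 0 t)).prod (volume.restrict (Ioc 0 t)))) :
    ∫ s in (0 : ℝ)..t, ∫ r in (0 : ℝ)..s, f s r = ∫ r in (0 : ℝ)..t, ∫ s in r..t, f s r := by
  have hind : Integrable (fun p : ℝ × ℝ => {p : ℝ × ℝ | p.2 ≤ p.1}.indicator (fun p => f p.1 p.2) p)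
      ((volume.restrict (Ioc 0 t)).prod (volume.restrict (Ioc 0 t))) :=
    hf.indicator (measurableSet_le measurable_snd measurable_fst)
  have hswap := integral_integral_swap (f := fun s r => {p : ℝ × ℝ | p.2 ≤ p.1}.indicator
    (fun p => f p.1 p.2) (s, r)) hind
  rw [intervalIntegral.integral_of_le ht, intervalIntegral.integral_of_le ht]
  refine Eq.trans (setIntegral_congr_fun measurableSet_Ioc fun s hs => ?_) (hswap.trans
    (setIntegral_congr_ae measurableSet_Ioc ?_))
  · have h1 : (fun r => {p : ℝ × ℝ | p.2 ≤ p.1}.indicator (fun p => f p.1 p.2) (s, r)) =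
        (Iic s).indicator fun r => f s r := by
      ext r
      by_cases h : r ≤ s <;> simp [h]
    simp only [h1]
    rw [integral_indicator measurableSet_Iic, Measure.restrict_restrict measurableSet_Iic,
      intervalIntegral.integral_of_le hs.1.le]
    congr 2
    ext r
    simp only [mem_Ioc, mem_inter_iff, mem_Iic]
    constructor
    · rintro ⟨h, h'⟩; exact ⟨h', h, h'.trans hs.2⟩
    · rintro ⟨h, h', -⟩; exact ⟨h', h⟩
  · refine ae_of_all _ fun r hr => ?_
    have h1 : (fun s => {p : ℝ × ℝ | p.2 ≤ p.1}.indicator (fun p => f p.1 p.2) (s, r)) =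
        (Ici r).indicator fun s => f s r := by
      ext s
      by_cases h : r ≤ s <;> simp [h]
    simp only [h1]
    rw [integral_indicator measurableSet_Ici, Measure.restrict_restrict measurableSet_Ici,
      intervalIntegral.integral_of_le hr.2, ← integral_Icc_eq_integral_Ioc]
    congr 2
    ext s
    simp only [mem_Ioc, mem_inter_iff, mem_Ici, mem_Icc]
    constructor
    · rintro ⟨h, -, h'⟩; exact ⟨h, h'⟩
    · rintro ⟨h, h'⟩; exact ⟨h, hr.1.trans_le h, h'⟩

/-- An integrated form of Gronwall's inequality that does not presuppose continuity. -/
theorem exp_mul_integral_le_of_le_add_integral {a α : ℝ → ℝ} {C t : ℝ} (ht : 0 ≤ t)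
    (ha : IntervalIntegrable a volume 0 t) (hα : IntervalIntegrable α volume 0 t)
    (h : ∀ s, 0 ≤ s → s ≤ t → a s ≤ α s + C * ∫ r in (0 : ℝ)..s, a r) :
    Real.exp (-(C * t)) * ∫ r in (0 : ℝ)..t, a r ≤
      ∫ s in (0 : ℝ)..t, Real.exp (-(C * s)) * α s := by
  have hexp : Continuous fun s => Real.exp (-(C * s)) := by fun_prop
  have hA : ContinuousOn (fun s => ∫ r in (0 : ℝ)..s, a r) (uIcc 0 t) := by
    refine intervalIntegral.continuousOn_primitive_interval ?_
    rw [uIcc_of_le ht]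
    exact (intervalIntegrable_iff_integrableOn_Icc_of_le ht).mp ha
  have h1 : IntervalIntegrable (fun s => Real.exp (-(C * s)) * a s) volume 0 t :=
    ha.continuousOn_mul hexp.continuousOn
  have h2 : IntervalIntegrable (fun s => Real.exp (-(C * s)) * α s) volume 0 t :=
    hα.continuousOn_mul hexp.continuousOn
  have h3 : IntervalIntegrable (fun s => Real.exp (-(C * s)) * (C * ∫ r in (0 : ℝ)..s, a r))
      volume 0 t :=
    (hexp.continuousOn.mul (continuousOn_const.mul hA)).intervalIntegrable
  have hle : ∫ s in (0 : ℝ)..t, Real.exp (-(C * s)) * a s ≤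
      ∫ s in (0 : ℝ)..t, (Real.exp (-(C * s)) * α s +
        Real.exp (-(C * s)) * (C * ∫ r in (0 : ℝ)..s, a r)) := by
    refine intervalIntegral.integral_mono_on ht h1 (h2.add h3) fun s hs => ?_
    rw [← mul_add]
    exact mul_le_mul_of_nonneg_left (h s hs.1 hs.2) (Real.exp_nonneg _)
  rw [intervalIntegral.integral_add h2 h3] at hle
  -- Fubini replaces the product rule: integrating out `s` leaves the difference of the weights at
  -- `r` and `t`. The first part cancels the left side of `hle`; the second is the assertion.
  have hswap := intervalIntegral_triangle_swap (f := fun s r => Real.exp (-(C * s)) * C * a r) ht (by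
    have hi : IntegrableOn (fun s => Real.exp (-(C * s)) * C) (Ioc 0 t) :=
      ((hexp.mul continuous_const).intervalIntegrable 0 t).1
    exact hi.mul_prod ha.1)
  have e1 : ∫ s in (0 : ℝ)..t, Real.exp (-(C * s)) * (C * ∫ r in (0 : ℝ)..s, a r) =
      ∫ s in (0 : ℝ)..t, ∫ r in (0 : ℝ)..s, Real.exp (-(C * s)) * C * a r := by
    simp only [intervalIntegral.integral_const_mul, mul_assoc]
  have e2 : ∫ r in (0 : ℝ)..t, ∫ s in r..t, Real.exp (-(C * s)) * C * a r =
      ∫ r in (0 : ℝ)..t, (Real.exp (-(C * r)) * a r - Real.exp (-(C * t)) * a r) := by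
    refine intervalIntegral.integral_congr fun r _ => ?_
    simp only [intervalIntegral.integral_mul_const]
    rw [← sub_mul]
    congr 1
    have hd (x : ℝ) : HasDerivAt (fun s => -Real.exp (-(C * s))) (Real.exp (-(C * x)) * C) x := by
      refine ((((hasDerivAt_id x).const_mul C).neg).exp).neg.congr_deriv ?_
      simp
    rw [← intervalIntegral.integral_mul_const, intervalIntegral.integral_eq_sub_of_hasDerivAt (fun x _ => hd x)
      ((hexp.mul continuous_const).intervalIntegrable _ _)]
    ring
  rw [e1, hswap, e2, intervalIntegral.integral_sub h1 (ha.const_mul _),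
    intervalIntegral.integral_const_mul] at hle
  linarith

end Triangle

/-! ### Local martingales: supermartingale property and moment bounds -/

section LocalMartingales

set_option linter.unusedSectionVars false

variable {Ω : Type*} [mΩ : MeasurableSpace Ω] {P : Measure Ω} {ℱ : Filtration ℝ≥0 mΩ}

/-- The process stopped at `τ`, set to zero where `τ = 0`. -/
abbrev stoppedAt (N : ℝ≥0 → Ω → ℝ) (τ : Ω → WithTop ℝ≥0) : ℝ≥0 → Ω → ℝ :=
  stoppedProcess (fun i => {ω | ⊥ < τ ω}.indicator (N i)) τ

theorem stoppedAt_eq_of_lt {N : ℝ≥0 → Ω → ℝ} {τ : Ω → WithTop ℝ≥0} {t : ℝ≥0} {ω : Ω}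
    (h : (t : WithTop ℝ≥0) < τ ω) : stoppedAt N τ t ω = N t ω := by
  rw [stoppedAt, stoppedProcess_eq_of_le h.le, indicator_of_mem]
  exact bot_le.trans_lt h

theorem stoppedAt_eq_min {N : ℝ≥0 → Ω → ℝ} {τ : Ω → WithTop ℝ≥0} {ω : Ω} (h : ⊥ < τ ω)
    (t : ℝ≥0) : stoppedAt N τ t ω = N (min (t : WithTop ℝ≥0) (τ ω)).untopA ω := by
  rw [stoppedAt, stoppedProcess, indicator_of_mem]
  exact h

theorem stoppedAt_eq_zero {N : ℝ≥0 → Ω → ℝ} {τ : Ω → WithTop ℝ≥0} {ω : Ω} (h : ¬ ⊥ < τ ω)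
    (t : ℝ≥0) : stoppedAt N τ t ω = 0 := by
  rw [stoppedAt, stoppedProcess, indicator_of_notMem]
  exact h

theorem coe_min_untopA (t : ℝ≥0) (u : WithTop ℝ≥0) :
    (((min (t : WithTop ℝ≥0) u).untopA : ℝ≥0) : WithTop ℝ≥0) = min (t : WithTop ℝ≥0) u := by
  cases u with
  | top => rw [min_eq_left le_top]; rfl
  | coe u => rw [← WithTop.coe_min]; rfl

theorem min_untopA_le (t : ℝ≥0) (u : WithTop ℝ≥0) : (min (t : WithTop ℝ≥0) u).untopA ≤ t := by
  exact WithTop.coe_le_coe.mp ((coe_min_untopA t u).le.trans (min_le_left _ _))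

theorem stoppedAt_rightContinuous {N : ℝ≥0 → Ω → ℝ} {τ : Ω → WithTop ℝ≥0} {ω : Ω}
    (h : ∀ t, ContinuousWithinAt (fun r => N r ω) (Ici t) t) (t : ℝ≥0) :
    ContinuousWithinAt (fun r => stoppedAt N τ r ω) (Ici t) t := by
  rcases lt_or_ge (t : WithTop ℝ≥0) (τ ω) with ht | ht
  · have h1 : ∀ᶠ r in 𝓝[Ici t] t, stoppedAt N τ r ω = N r ω := by
      have : ∀ᶠ r : ℝ≥0 in 𝓝 t, (r : WithTop ℝ≥0) < τ ω := by
        cases hτ : τ ω with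
        | top => exact Eventually.of_forall fun r => WithTop.coe_lt_top r
        | coe u =>
          rw [hτ] at ht
          exact (eventually_lt_nhds (WithTop.coe_lt_coe.mp ht)).mono
            fun r hr => WithTop.coe_lt_coe.mpr hr
      filter_upwards [nhdsWithin_le_nhds this] with r hr using stoppedAt_eq_of_lt hr
    exact (h t).congr_of_eventuallyEq h1 (stoppedAt_eq_of_lt ht)
  · have h1 : ∀ r ∈ Ici t, stoppedAt N τ r ω = stoppedAt N τ t ω := by
      intro r hr
      rw [stoppedAt, stoppedProcess_eq_of_ge ht,
        stoppedProcess_eq_of_ge (ht.trans (WithTop.coe_le_coe.mpr hr))]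
    exact continuousWithinAt_const.congr h1 (h1 t self_mem_Ici)

theorem eventually_coe_lt {τ : ℕ → WithTop ℝ≥0} (h : Tendsto τ atTop (𝓝 ⊤)) (t : ℝ≥0) :
    ∀ᶠ n in atTop, (t : WithTop ℝ≥0) < τ n :=
  h.eventually_const_lt (WithTop.coe_lt_top t)

theorem MeasureTheory.Martingale.integral_abs_mono {M : ℝ≥0 → Ω → ℝ} (hM : Martingale M ℱ P) {s t : ℝ≥0}
    (hst : s ≤ t) : ∫ ω, |M s ω| ∂P ≤ ∫ ω, |M t ω| ∂P := by
  calc ∫ ω, |M s ω| ∂P = ∫ ω, |P[M t | ℱ s] ω| ∂P :=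
        integral_congr_ae ((hM.2 s t hst).symm.fun_comp fun x => |x|)
    _ ≤ _ := integral_abs_condExp_le _

variable [IsProbabilityMeasure P]

/-- A local martingale that is bounded below by an integrable random variable is a
supermartingale. -/
theorem setIntegral_le_of_locally_martingale {N : ℝ≥0 → Ω → ℝ}
    (hN : Locally (fun M => Martingale M ℱ P) ℱ N P) {s t : ℝ≥0} (hst : s ≤ t)
    (hNs : Integrable (N s) P) (hNt : Integrable (N t) P) {R : Ω → ℝ} (hR : Integrable R P)
    (hR0 : 0 ≤ R) (hle : ∀ᵐ ω ∂P, ∀ r ≤ t, -R ω ≤ N r ω) {A : Set Ω} (hA : MeasurableSet[ℱ s] A) :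
    ∫ ω in A, N t ω ∂P ≤ ∫ ω in A, N s ω ∂P := by
  obtain ⟨τ, hτ, hM⟩ := hN
  -- On `B k` every stopping time with index `n ≥ k` exceeds `s`, so the stopped process at `s` is
  -- `N s` and the expectations below do not depend on `n`.
  set B : ℕ → Set Ω := fun k => A ∩ {ω | (s : WithTop ℝ≥0) < τ k ω}
  have hBs (k : ℕ) : MeasurableSet[ℱ s] (B k) := hA.inter ((hτ.isStoppingTime k).measurableSet_gt s)
  have hB (k : ℕ) : MeasurableSet (B k) := ℱ.le s _ (hBs k)
  have hge (n : ℕ) : ∀ᵐ ω ∂P, ∀ r ≤ t, 0 ≤ stoppedAt N (τ n) r ω + R ω := by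
    filter_upwards [hle] with ω hω r hr
    by_cases h : ⊥ < τ n ω
    · rw [stoppedAt_eq_min h]
      linarith [hω _ ((min_untopA_le r (τ n ω)).trans hr)]
    -- A path stopped at time zero is set to zero, so the lower bound there relies on `R ≥ 0`.
    · rw [stoppedAt_eq_zero h, zero_add]
      exact hR0 ω
  have hstep (k : ℕ) : ∫ ω in B k, N t ω ∂P ≤ ∫ ω in B k, N s ω ∂P := by
    have hev : ∀ n ≥ k, ∫⁻ ω in B k, ENNReal.ofReal (stoppedAt N (τ n) t ω + R ω) ∂P =
        ENNReal.ofReal (∫ ω in B k, (N s ω + R ω) ∂P) := by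
      intro n hn
      rw [← ofReal_integral_eq_lintegral_ofReal (f := fun ω => stoppedAt N (τ n) t ω + R ω)
        ((((hM n).integrable t).add hR).integrableOn)
        (ae_restrict_of_ae ((hge n).mono fun ω h => h t le_rfl))]
      congr 1
      have hMs : ∫ ω in B k, stoppedAt N (τ n) t ω ∂P = ∫ ω in B k, N s ω ∂P := by
        rw [← (hM n).setIntegral_eq hst (hBs k)]
        refine setIntegral_congr_ae (hB k) ?_
        filter_upwards [hτ.mono] with ω hω hmem
        exact stoppedAt_eq_of_lt (hmem.2.trans_le (hω hn))
      rw [integral_add hNs.integrableOn hR.integrableOn, ← hMs]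
      exact integral_add ((hM n).integrable t).integrableOn hR.integrableOn
    have hfatou : ∫⁻ ω in B k, ENNReal.ofReal (N t ω + R ω) ∂P ≤
        ENNReal.ofReal (∫ ω in B k, (N s ω + R ω) ∂P) := by
      calc ∫⁻ ω in B k, ENNReal.ofReal (N t ω + R ω) ∂P
          = ∫⁻ ω in B k, liminf (fun n => ENNReal.ofReal (stoppedAt N (τ n) t ω + R ω)) atTop ∂P := by
            refine lintegral_congr_ae (ae_restrict_of_ae ?_)
            filter_upwards [hτ.tendsto_top] with ω hω
            refine (Tendsto.liminf_eq (tendsto_const_nhds.congr' ?_)).symm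
            filter_upwards [eventually_coe_lt hω t] with n hn
            rw [stoppedAt_eq_of_lt hn]
        _ ≤ liminf (fun n => ∫⁻ ω in B k, ENNReal.ofReal (stoppedAt N (τ n) t ω + R ω) ∂P) atTop :=
            lintegral_liminf_le' fun n =>
              ((((hM n).integrable t).add hR).1.aemeasurable.ennreal_ofReal).restrict
        _ = ENNReal.ofReal (∫ ω in B k, (N s ω + R ω) ∂P) := by
            refine Tendsto.liminf_eq (tendsto_const_nhds.congr' ?_)
            filter_upwards [eventually_ge_atTop k] with n hn using (hev n hn).symm
    rw [← ofReal_integral_eq_lintegral_ofReal (f := fun ω => N t ω + R ω) ((hNt.add hR).integrableOn)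
      (ae_restrict_of_ae (hle.mono fun ω h => by
        have := h t le_rfl
        change 0 ≤ N t ω + R ω
        linarith))] at hfatou
    have hnn : 0 ≤ ∫ ω in B k, (N s ω + R ω) ∂P :=
      integral_nonneg_of_ae (ae_restrict_of_ae (hle.mono fun ω h => by
        have := h s hst
        change 0 ≤ N s ω + R ω
        linarith))
    have h2 := (ENNReal.ofReal_le_ofReal_iff hnn).mp hfatou
    change ∫ ω in B k, (N t ω + R ω) ∂P ≤ _ at h2
    rw [integral_add hNs.integrableOn hR.integrableOn,
      integral_add hNt.integrableOn hR.integrableOn] at h2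
    linarith
  have hlim (f : Ω → ℝ) (hf : Integrable f P) :
      Tendsto (fun k => ∫ ω in B k, f ω ∂P) atTop (𝓝 (∫ ω in A, f ω ∂P)) := by
    simp only [← integral_indicator (hB _), ← integral_indicator (ℱ.le s _ hA)]
    refine tendsto_integral_of_dominated_convergence (fun ω => |f ω|)
      (fun k => (hf.indicator (hB k)).1) hf.abs (fun k => ae_of_all _ fun ω => ?_) ?_
    · exact norm_indicator_le_norm_self f ω
    · filter_upwards [hτ.tendsto_top] with ω hω
      refine tendsto_const_nhds.congr' ?_
      filter_upwards [eventually_coe_lt hω s] with k hk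
      have : ω ∈ B k ↔ ω ∈ A := ⟨fun h => h.1, fun h => ⟨h, hk⟩⟩
      by_cases h : ω ∈ A
      · rw [indicator_of_mem h, indicator_of_mem (this.mpr h)]
      · rw [indicator_of_notMem h, indicator_of_notMem (fun h' => h (this.mp h'))]
  exact le_of_tendsto_of_tendsto' (hlim _ hNt) (hlim _ hNs) hstep

/-- A stopped càdlàg process is integrable in time. -/
theorem IsCadlag.intervalIntegrable_stopped {F : ℝ≥0 → ℝ} (hF : IsCadlag F) (u : WithTop ℝ≥0)
    (t : ℝ≥0) : IntervalIntegrable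
      (fun s : ℝ => F (min (s.toNNReal : WithTop ℝ≥0) u).untopA) volume 0 t := by
  cases u with
  | top =>
    simp only [min_eq_left le_top]
    exact hF.intervalIntegrable 0 t
  | coe u =>
    simp only [← WithTop.coe_min]
    change IntervalIntegrable (fun s : ℝ => F (min s.toNNReal u)) volume 0 t
    obtain ⟨B, hB⟩ := hF.exists_abs_le t
    have hm : Measurable fun s : ℝ => F (min s.toNNReal u) :=
      (measurable_of_rightContinuous fun t => (hF t).1).comp
        (measurable_real_toNNReal.min measurable_const)
    rw [intervalIntegrable_iff_integrableOn_Ioc_of_le t.coe_nonneg]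
    refine Measure.integrableOn_of_bounded (M := B) (by simp) hm.aestronglyMeasurable ?_
    filter_upwards [ae_restrict_mem measurableSet_Ioc] with s hs
    exact hB _ ((min_le_left _ _).trans (Real.toNNReal_le_iff_le_coe.mpr hs.2))

/-- The pathwise Gronwall estimate for a stopped process: `M` is the stopped compensated process
and `u` the time of stopping. -/
theorem stopped_le_of_density_le {F b M : ℝ≥0 → ℝ} {c C : ℝ} {u : WithTop ℝ≥0} {t : ℝ≥0}
    (hF0 : ∀ s, 0 ≤ F s) (hF : IsCadlag F) (hC : 0 ≤ C) (hb : ∀ s, b s ≤ C * F s)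
    (hbi : ∀ t : ℝ≥0, IntervalIntegrable (fun s : ℝ => b s.toNNReal) volume 0 t)
    (hinit : F 0 = c)
    (hMpos : ⊥ < u → ∀ s : ℝ≥0, M s = F (min (s : WithTop ℝ≥0) u).untopA - F 0 -
      ∫ r in (0 : ℝ)..(min (s : WithTop ℝ≥0) u).untopA, b r.toNNReal)
    (hMbot : ¬ ⊥ < u → ∀ s, M s = 0)
    (hMi : IntegrableOn (fun s : ℝ => M s.toNNReal) (Ioc 0 t)) :
    F (min (t : WithTop ℝ≥0) u).untopA ≤ c + M t + C * Real.exp (C * t) *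
      ∫ s in (0 : ℝ)..t, Real.exp (-(C * s)) * (c + M s.toNNReal) := by
  set a : ℝ≥0 → ℝ := fun s => F (min (s : WithTop ℝ≥0) u).untopA with hadef
  have hai : IntervalIntegrable (fun s : ℝ => a s.toNNReal) volume 0 t :=
    hF.intervalIntegrable_stopped u t
  have hineq : ∀ s : ℝ, 0 ≤ s → s ≤ t → a s.toNNReal ≤
      (c + M s.toNNReal) + C * ∫ r in (0 : ℝ)..s, a r.toNNReal := by
    intro s hs0 hst
    have hnn : 0 ≤ ∫ r in (0 : ℝ)..s, a r.toNNReal :=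
      intervalIntegral.integral_nonneg hs0 fun r _ => hF0 _
    by_cases h : ⊥ < u
    · have hMval := hMpos h s.toNNReal
      change F (min (s.toNNReal : WithTop ℝ≥0) u).untopA ≤ _
      have hus := min_untopA_le s.toNNReal u
      have huu : ((min (s.toNNReal : WithTop ℝ≥0) u).untopA : WithTop ℝ≥0) ≤ u :=
        (coe_min_untopA _ _).le.trans (min_le_right _ _)
      generalize (min (s.toNNReal : WithTop ℝ≥0) u).untopA = v at hMval hus huu ⊢
      have hvs : (v : ℝ) ≤ s :=
        (NNReal.coe_le_coe.mpr hus).trans (Real.coe_toNNReal s hs0).le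
      -- `v` is the minimum of `s` and `u`. Up to `v` the stopped path `a` is `F`, so the density is
      -- at most `C * a`; nonnegativity then extends the integral to `s`.
      have h1 : ∫ r in (0 : ℝ)..v, b r.toNNReal ≤ ∫ r in (0 : ℝ)..v, C * a r.toNNReal := by
        refine intervalIntegral.integral_mono_on v.coe_nonneg (hbi v)
          ((hai.mono_set ?_).const_mul C) fun r hr => ?_
        · rw [uIcc_of_le v.coe_nonneg, uIcc_of_le t.coe_nonneg]
          exact Icc_subset_Icc_right (hvs.trans hst)
        · have h2 : (r.toNNReal : WithTop ℝ≥0) ≤ u :=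
            (WithTop.coe_le_coe.mpr (Real.toNNReal_le_iff_le_coe.mpr hr.2)).trans huu
          have h3 : (min (r.toNNReal : WithTop ℝ≥0) u).untopA = r.toNNReal := by
            rw [min_eq_left h2]; rfl
          simp only [hadef, h3]
          exact hb _
      have h2 : ∫ r in (0 : ℝ)..v, a r.toNNReal ≤ ∫ r in (0 : ℝ)..s, a r.toNNReal := by
        refine intervalIntegral.integral_mono_interval le_rfl v.coe_nonneg hvs
          (ae_of_all _ fun r => hF0 _) (hai.mono_set ?_)
        rw [uIcc_of_le hs0, uIcc_of_le t.coe_nonneg]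
        exact Icc_subset_Icc_right hst
      rw [intervalIntegral.integral_const_mul] at h1
      have h3 := mul_le_mul_of_nonneg_left h2 hC
      rw [hMval, hinit]
      linarith
    · have hbot : u = ⊥ := by simpa [bot_lt_iff_ne_bot] using h
      have h0 : (min (s.toNNReal : WithTop ℝ≥0) u).untopA = 0 := by
        rw [hbot, min_eq_right bot_le]
        rfl
      have h1 : a s.toNNReal = c := by simp only [hadef, h0, hinit]
      rw [h1, hMbot h]
      have := mul_nonneg hC hnn
      linarith
  have hα : IntervalIntegrable (fun s : ℝ => c + M s.toNNReal) volume 0 t :=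
    intervalIntegrable_const.add ((intervalIntegrable_iff_integrableOn_Ioc_of_le t.coe_nonneg).mpr hMi)
  have hgron := exp_mul_integral_le_of_le_add_integral t.coe_nonneg hai hα hineq
  have hlast := hineq t t.coe_nonneg le_rfl
  rw [Real.toNNReal_coe] at hlast
  have h1 := mul_le_mul_of_nonneg_left hgron (Real.exp_nonneg (C * t))
  rw [← mul_assoc, ← Real.exp_add, add_neg_cancel, Real.exp_zero, one_mul] at h1
  have h2 := mul_le_mul_of_nonneg_left h1 hC
  linarith

/-- The first absolute moment of a martingale is nondecreasing in time, hence bounded on `[0, t]` by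
its value at `t`. -/
theorem MeasureTheory.Martingale.integrable_uncurry {M : ℝ≥0 → Ω → ℝ} (hM : Martingale M ℱ P)
    (hMc : ∀ᵐ ω ∂P, ∀ t, ContinuousWithinAt (fun r => M r ω) (Ici t) t) (t : ℝ≥0) :
    Integrable (fun p : ℝ × Ω => M p.1.toNNReal p.2)
      ((volume.restrict (Ioc (0 : ℝ) t)).prod P) := by
  have hmeas := aestronglyMeasurable_uncurry_of_rightContinuous
    (ρ := volume.restrict (Ioc (0 : ℝ) t)) (P := P) (Y := M) (fun s => (hM.integrable s).1) hMc
  refine (integrable_prod_iff hmeas).mpr ⟨ae_of_all _ fun s => hM.integrable s.toNNReal, ?_⟩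
  refine Integrable.of_bound (C := ∫ ω, |M t ω| ∂P) hmeas.norm.integral_prod_right' ?_
  filter_upwards [ae_restrict_mem measurableSet_Ioc] with s hs
  rw [Real.norm_of_nonneg (integral_nonneg fun _ => norm_nonneg _)]
  exact hM.integral_abs_mono (Real.toNNReal_le_iff_le_coe.mpr hs.2)

/-- The weighted time integral of a centred martingale has the expectation of its constant part. -/
theorem MeasureTheory.Martingale.integral_exp_mul_le {M : ℝ≥0 → Ω → ℝ} (hM : Martingale M ℱ P)
    (hMc : ∀ᵐ ω ∂P, ∀ t, ContinuousWithinAt (fun r => M r ω) (Ici t) t)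
    (hmean : ∀ s, ∫ ω, M s ω ∂P = 0) {c C : ℝ} (hc : 0 ≤ c) (hC : 0 ≤ C) (t : ℝ≥0) :
    Integrable (fun ω => ∫ s in (0 : ℝ)..t, Real.exp (-(C * s)) * (c + M s.toNNReal ω)) P ∧
    ∫ ω, (∫ s in (0 : ℝ)..t, Real.exp (-(C * s)) * (c + M s.toNNReal ω)) ∂P ≤ c * t := by
  have hexp1 : ∀ s ∈ Ioc (0 : ℝ) t, Real.exp (-(C * s)) ≤ 1 := fun s hs => by
    rw [Real.exp_le_one_iff]
    have := mul_nonneg hC hs.1.le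
    linarith
  have hprod : Integrable (fun p : ℝ × Ω => Real.exp (-(C * p.1)) * (c + M p.1.toNNReal p.2))
      ((volume.restrict (Ioc (0 : ℝ) t)).prod P) := by
    refine ((integrable_const c).add (hM.integrable_uncurry hMc t)).bdd_mul (c := 1) ?_ ?_
    · exact (((measurable_const.mul measurable_fst).neg).exp).aestronglyMeasurable
    · have : ∀ᵐ s ∂(volume.restrict (Ioc (0 : ℝ) t)), ‖Real.exp (-(C * s))‖ ≤ 1 := by
        filter_upwards [ae_restrict_mem measurableSet_Ioc] with s hs
        rw [Real.norm_of_nonneg (Real.exp_nonneg _)]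
        exact hexp1 s hs
      exact Measure.quasiMeasurePreserving_fst.ae this
  simp only [intervalIntegral.integral_of_le t.coe_nonneg]
  refine ⟨hprod.integral_prod_right, ?_⟩
  rw [← integral_integral_swap hprod]
  have h1 (s : ℝ) : ∫ ω, Real.exp (-(C * s)) * (c + M s.toNNReal ω) ∂P =
      Real.exp (-(C * s)) * c := by
    rw [integral_const_mul, integral_add (integrable_const _) (hM.integrable _), hmean]
    simp
  simp only [h1]
  calc ∫ s in Ioc (0 : ℝ) t, Real.exp (-(C * s)) * c ≤ ∫ s in Ioc (0 : ℝ) t, c := by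
        refine setIntegral_mono_on ?_ (by simp) measurableSet_Ioc fun s hs => ?_
        · have : Continuous fun s => Real.exp (-(C * s)) * c := by fun_prop
          exact (this.intervalIntegrable 0 t).1
        · exact mul_le_of_le_one_left hc (hexp1 s hs)
    _ = c * t := by simp [mul_comm]

/-- A nonnegative process `F` whose compensator has a density dominated by `F` has
exponentially bounded expectations. -/
theorem integrable_of_locally_martingale_of_le {F b : ℝ≥0 → Ω → ℝ} {c C : ℝ}
    (hF0 : ∀ t ω, 0 ≤ F t ω) (hFm : ∀ t, AEStronglyMeasurable (F t) P)
    (hFc : ∀ ω, IsCadlag fun t => F t ω) (hC : 0 ≤ C) (hb : ∀ t ω, b t ω ≤ C * F t ω)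
    (hbi : ∀ᵐ ω ∂P, ∀ t : ℝ≥0, IntervalIntegrable (fun s : ℝ => b s.toNNReal ω) volume 0 t)
    (hinit : ∀ᵐ ω ∂P, F 0 ω = c)
    (hN : Locally (fun M => Martingale M ℱ P) ℱ
      (fun t ω => F t ω - F 0 ω - ∫ s in (0 : ℝ)..t, b s.toNNReal ω) P) (t : ℝ≥0) :
    Integrable (F t) P ∧ ∫ ω, F t ω ∂P ≤ c + C * Real.exp (C * t) * (c * t) := by
  obtain ⟨τ, hτ, hM⟩ := hN
  have hc : 0 ≤ c := by
    obtain ⟨ω, hω⟩ := hinit.exists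
    exact hω ▸ hF0 0 ω
  have hNc : ∀ᵐ ω ∂P, ∀ t : ℝ≥0, ContinuousWithinAt
      (fun r : ℝ≥0 => F r ω - F 0 ω - ∫ s in (0 : ℝ)..r, b s.toNNReal ω) (Ici t) t := by
    filter_upwards [hbi] with ω hω t
    refine (((hFc ω t).1.sub continuousWithinAt_const).sub ?_)
    have h1 : ContinuousOn (fun x => ∫ s in (0 : ℝ)..x, b s.toNNReal ω)
        (uIcc 0 ((t + 1 : ℝ≥0) : ℝ)) := by
      refine intervalIntegral.continuousOn_primitive_interval ?_
      rw [uIcc_of_le (by positivity)]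
      exact (intervalIntegrable_iff_integrableOn_Icc_of_le (by positivity)).mp (hω (t + 1))
    have h2 : ContinuousOn (fun x : ℝ≥0 => ∫ s in (0 : ℝ)..x, b s.toNNReal ω) (Iio (t + 1)) := by
      refine h1.comp NNReal.continuous_coe.continuousOn fun x hx => ?_
      rw [uIcc_of_le (by positivity)]
      exact ⟨x.2, NNReal.coe_le_coe.mpr (le_of_lt hx)⟩
    exact (h2.continuousAt (Iio_mem_nhds (lt_add_one t))).continuousWithinAt
  set N : ℝ≥0 → Ω → ℝ := fun t ω => F t ω - F 0 ω - ∫ s in (0 : ℝ)..t, b s.toNNReal ω with hN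
  have hMc (n : ℕ) : ∀ᵐ ω ∂P, ∀ t,
      ContinuousWithinAt (fun r => stoppedAt N (τ n) r ω) (Ici t) t :=
    hNc.mono fun ω h t => stoppedAt_rightContinuous h t
  have hM0 (n : ℕ) (ω : Ω) : stoppedAt N (τ n) 0 ω = 0 := by
    by_cases h : ⊥ < τ n ω
    · rw [stoppedAt_eq_min h]
      have : (min ((0 : ℝ≥0) : WithTop ℝ≥0) (τ n ω)).untopA = 0 :=
        le_antisymm (min_untopA_le _ _) zero_le
      rw [this]
      simp [hN]
    · exact stoppedAt_eq_zero h _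
  have hmean (n : ℕ) (s : ℝ≥0) : ∫ ω, stoppedAt N (τ n) s ω ∂P = 0 := by
    have h1 := (hM n).setIntegral_eq (zero_le (a := s)) MeasurableSet.univ
    simp only [Measure.restrict_univ] at h1
    rw [← h1]
    exact integral_eq_zero_of_ae (ae_of_all _ fun ω => hM0 n ω)
  have hZ (n : ℕ) := MeasureTheory.Martingale.integral_exp_mul_le (hM n) (hMc n) (hmean n) hc hC t
  set G : ℕ → Ω → ℝ := fun n ω => c + stoppedAt N (τ n) t ω + C * Real.exp (C * t) *
    ∫ s in (0 : ℝ)..t, Real.exp (-(C * s)) * (c + stoppedAt N (τ n) s.toNNReal ω) with hG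
  have hGint (n : ℕ) : Integrable (G n) P :=
    ((integrable_const c).add ((hM n).integrable t)).add ((hZ n).1.const_mul _)
  have hGmean (n : ℕ) : ∫ ω, G n ω ∂P ≤ c + C * Real.exp (C * t) * (c * t) := by
    have h1 : Integrable (fun ω => c + stoppedAt N (τ n) t ω) P :=
      (integrable_const c).add ((hM n).integrable t)
    simp only [hG]
    rw [integral_add h1 ((hZ n).1.const_mul _), integral_add (integrable_const c)
      ((hM n).integrable t), hmean, integral_const_mul]
    simp only [integral_const, probReal_univ, one_smul, add_zero]
    gcongr
    exact (hZ n).2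
  -- Gronwall is applied path by path, before taking expectations, as no moment of `F` at the
  -- stopped time is known beforehand. The bound `G n` involves only the centred martingale, so its
  -- expectation is controlled independently of `n`.
  have hpath (n : ℕ) : ∀ᵐ ω ∂P, F (min (t : WithTop ℝ≥0) (τ n ω)).untopA ω ≤ G n ω := by
    have hMi : ∀ᵐ ω ∂P, IntegrableOn (fun s : ℝ => stoppedAt N (τ n) s.toNNReal ω) (Ioc 0 t) :=
      ((hM n).integrable_uncurry (hMc n) t).prod_left_ae
    filter_upwards [hbi, hinit, hMi] with ω hbω hinitω hMω
    exact stopped_le_of_density_le (F := fun t => F t ω) (b := fun t => b t ω)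
      (M := fun t => stoppedAt N (τ n) t ω) (u := τ n ω) (fun s => hF0 s ω) (hFc ω) hC
      (fun s => hb s ω) hbω hinitω (fun h s => stoppedAt_eq_min h s)
      (fun h s => stoppedAt_eq_zero h s) hMω
  have hfatou : ∫⁻ ω, ENNReal.ofReal (F t ω) ∂P ≤
      ENNReal.ofReal (c + C * Real.exp (C * t) * (c * t)) := by
    calc ∫⁻ ω, ENNReal.ofReal (F t ω) ∂P
        ≤ ∫⁻ ω, liminf (fun n => ENNReal.ofReal (G n ω)) atTop ∂P := by
          refine lintegral_mono_ae ?_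
          filter_upwards [ae_all_iff.mpr hpath, hτ.tendsto_top] with ω hω hτω
          refine le_liminf_of_le (by isBoundedDefault) ?_
          filter_upwards [eventually_coe_lt hτω t] with n hn
          refine ENNReal.ofReal_le_ofReal ?_
          have h1 := hω n
          rw [min_eq_left hn.le] at h1
          exact h1
      _ ≤ liminf (fun n => ∫⁻ ω, ENNReal.ofReal (G n ω) ∂P) atTop :=
          lintegral_liminf_le' fun n => (hGint n).1.aemeasurable.ennreal_ofReal
      _ ≤ ENNReal.ofReal (c + C * Real.exp (C * t) * (c * t)) := by
          refine liminf_le_of_frequently_le' (Frequently.of_forall fun n => ?_)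
          rw [← ofReal_integral_eq_lintegral_ofReal (hGint n)
            ((hpath n).mono fun ω h => (hF0 _ _).trans h)]
          exact ENNReal.ofReal_le_ofReal (hGmean n)
  have hint : Integrable (F t) P := by
    refine ⟨hFm t, ?_⟩
    rw [hasFiniteIntegral_iff_ofReal (ae_of_all _ fun ω => hF0 t ω)]
    exact hfatou.trans_lt ENNReal.ofReal_lt_top
  refine ⟨hint, ?_⟩
  rw [← ofReal_integral_eq_lintegral_ofReal hint (ae_of_all _ fun ω => hF0 t ω)] at hfatou
  exact (ENNReal.ofReal_le_ofReal_iff (by positivity)).mp hfatou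

end LocalMartingales

/-! ### Moments and martingale property of solutions -/

section Solutions

set_option linter.unusedSectionVars false

variable {K : Type*} [TopologicalSpace K] [CompactSpace K] [T2Space K] [MeasurableSpace K]
  [BorelSpace K] {D : Submodule ℝ C(K, ℝ)} {S : Set (SignedMeasure K)}
  {L : cylDomain D →ₗ[ℝ] measurableMaps K}
  {Ω : Type*} [mΩ : MeasurableSpace Ω] {P : Measure Ω} [IsProbabilityMeasure P]
  {ℱ : Filtration ℝ≥0 mΩ} {ν₀ : FiniteMeasure K} {X : ℝ≥0 → Ω → FiniteMeasure K}

theorem continuous_mass_pow (k : ℕ) :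
    Continuous fun ν : FiniteMeasure K => (ν.mass : ℝ) ^ k :=
  (NNReal.continuous_coe.comp FiniteMeasure.continuous_mass).pow k

theorem SolvesMartingaleProblem.stronglyMeasurable_comp (hX : SolvesMartingaleProblem L P ℱ ν₀ X)
    {h : FiniteMeasure K → ℝ} (hh : Continuous h) (t : ℝ≥0) :
    StronglyMeasurable[ℱ t] fun ω => h (X t ω) :=
  hh.comp_stronglyMeasurable (hX.adapted t)

/-- All moments of the total mass of a solution are bounded on bounded time intervals. -/
theorem SolvesMartingaleProblem.exists_integral_mass_pow_le
    (hX : SolvesMartingaleProblem L P ℱ ν₀ X) (hD1 : (1 : C(K, ℝ)) ∈ D)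
    (hmass : ∀ k, ∃ C : ℝ, 0 ≤ C ∧ ∀ ν : FiniteMeasure K,
      |(L (massPow hD1 k) : SignedMeasure K → ℝ) (toSigned ν)| ≤ C * (1 + (ν.mass : ℝ) ^ k))
    (k : ℕ) (T : ℝ≥0) : ∃ B : ℝ, 0 ≤ B ∧ ∀ t ≤ T,
      Integrable (fun ω => 1 + ((X t ω).mass : ℝ) ^ k) P ∧
      ∫ ω, (1 + ((X t ω).mass : ℝ) ^ k) ∂P ≤ B := by
  obtain ⟨C₀, hC₀, h₀⟩ := hmass 0
  obtain ⟨C₁, hC₁, h₁⟩ := hmass k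
  -- Adding the constant 1 makes the drift bound a multiple of the function itself. The drift of the
  -- constant is at most `C₀ * (1 + 1)`, whence `2 * C₀` in `C`.
  set f : cylDomain D := massPow hD1 0 + massPow hD1 k with hf
  have hfval (ν : FiniteMeasure K) :
      (f : SignedMeasure K → ℝ) (toSigned ν) = 1 + (ν.mass : ℝ) ^ k := by
    rw [hf, Submodule.coe_add, Pi.add_apply, massPow_toSigned, massPow_toSigned, pow_zero]
  set C : ℝ := 2 * C₀ + C₁ with hC
  have hLf (ν : FiniteMeasure K) :
      (L f : SignedMeasure K → ℝ) (toSigned ν) ≤ C * (1 + (ν.mass : ℝ) ^ k) := by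
    have h2 : (L f : SignedMeasure K → ℝ) (toSigned ν) =
        (L (massPow hD1 0) : SignedMeasure K → ℝ) (toSigned ν) +
        (L (massPow hD1 k) : SignedMeasure K → ℝ) (toSigned ν) := by
      rw [hf, map_add]; rfl
    have h3 := (le_abs_self _).trans (h₀ ν)
    have h4 := (le_abs_self _).trans (h₁ ν)
    have h5 : 0 ≤ (ν.mass : ℝ) ^ k := by positivity
    rw [h2, hC]
    rw [pow_zero] at h3
    nlinarith [mul_nonneg hC₀ h5]
  have hcad (ω : Ω) : IsCadlag fun t => 1 + ((X t ω).mass : ℝ) ^ k :=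
    (hX.cadlag ω).comp (f := fun ν : FiniteMeasure K => 1 + (ν.mass : ℝ) ^ k)
      (continuous_const.add (continuous_mass_pow k))
  have hlm := hX.local_martingale f
  have hmg : mgProcess (f : SignedMeasure K → ℝ) (L f : SignedMeasure K → ℝ) X =
      fun t ω => (1 + ((X t ω).mass : ℝ) ^ k) - (1 + ((X 0 ω).mass : ℝ) ^ k) -
        ∫ s in (0 : ℝ)..t, (L f : SignedMeasure K → ℝ) (toSigned (X s.toNNReal ω)) := by
    ext t ω
    simp only [mgProcess, hfval]
  rw [hmg] at hlm
  have key := integrable_of_locally_martingale_of_le (P := P) (ℱ := ℱ)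
    (F := fun t ω => 1 + ((X t ω).mass : ℝ) ^ k)
    (b := fun t ω => (L f : SignedMeasure K → ℝ) (toSigned (X t ω)))
    (c := 1 + (ν₀.mass : ℝ) ^ k) (C := C) (fun t ω => by positivity)
    (fun t => ((hX.stronglyMeasurable_comp (continuous_const.add (continuous_mass_pow k)) t).mono
      (ℱ.le t)).aestronglyMeasurable) hcad (by positivity) (fun t ω => hLf _)
    (hX.integrable f) (hX.initial.mono fun ω h => by rw [h]) hlm
  set c : ℝ := 1 + (ν₀.mass : ℝ) ^ k with hc
  refine ⟨c + C * Real.exp (C * T) * (c * T), by positivity, fun t ht => ⟨(key t).1, (key t).2.trans ?_⟩⟩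
  have ht' : (t : ℝ) ≤ T := NNReal.coe_le_coe.mpr ht
  gcongr

theorem SolvesMartingaleProblem.integrable_uncurry
    (hX : SolvesMartingaleProblem L P ℱ ν₀ X) {k : ℕ} {T : ℝ≥0} {B C : ℝ}
    (hB : ∀ t ≤ T, Integrable (fun ω => 1 + ((X t ω).mass : ℝ) ^ k) P ∧
      ∫ ω, (1 + ((X t ω).mass : ℝ) ^ k) ∂P ≤ B)
    {h : FiniteMeasure K → ℝ} (hh : Continuous h) (hle : ∀ ν, |h ν| ≤ C * (1 + (ν.mass : ℝ) ^ k)) :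
    (∀ t ≤ T, Integrable (fun ω => h (X t ω)) P) ∧
    Integrable (fun p : ℝ × Ω => h (X p.1.toNNReal p.2))
      ((volume.restrict (Ioc (0 : ℝ) T)).prod P) := by
  have hm (t : ℝ≥0) : AEStronglyMeasurable (fun ω => h (X t ω)) P :=
    ((hX.stronglyMeasurable_comp hh t).mono (ℱ.le t)).aestronglyMeasurable
  have hint (t : ℝ≥0) (ht : t ≤ T) : Integrable (fun ω => h (X t ω)) P :=
    ((hB t ht).1.const_mul C).mono' (hm t) (ae_of_all _ fun ω => hle _)
  refine ⟨hint, ?_⟩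
  have hmeas := aestronglyMeasurable_uncurry_of_rightContinuous
    (ρ := volume.restrict (Ioc (0 : ℝ) T)) (P := P) (Y := fun t ω => h (X t ω)) hm
    (ae_of_all _ fun ω t => hh.continuousAt.comp_continuousWithinAt (hX.cadlag ω t).1)
  have hC : 0 ≤ C := by
    have := (abs_nonneg _).trans (hle 0)
    have h2 : 0 < 1 + (((0 : FiniteMeasure K).mass : ℝ≥0) : ℝ) ^ k := by positivity
    exact nonneg_of_mul_nonneg_left this h2
  refine (integrable_prod_iff hmeas).mpr ⟨?_, ?_⟩
  · filter_upwards [ae_restrict_mem measurableSet_Ioc] with s hs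
    exact hint _ (Real.toNNReal_le_iff_le_coe.mpr hs.2)
  · refine Integrable.of_bound (C := C * B) hmeas.norm.integral_prod_right' ?_
    filter_upwards [ae_restrict_mem measurableSet_Ioc] with s hs
    have hs' : s.toNNReal ≤ T := Real.toNNReal_le_iff_le_coe.mpr hs.2
    rw [Real.norm_of_nonneg (integral_nonneg fun _ => norm_nonneg _)]
    calc ∫ ω, ‖h (X s.toNNReal ω)‖ ∂P ≤ ∫ ω, C * (1 + ((X s.toNNReal ω).mass : ℝ) ^ k) ∂P :=
          integral_mono (hint _ hs').norm ((hB _ hs').1.const_mul C) fun ω => hle _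
      _ ≤ C * B := by
          rw [integral_const_mul]
          exact mul_le_mul_of_nonneg_left (hB _ hs').2 hC

theorem SolvesMartingaleProblem.integrable_intervalIntegral
    (hX : SolvesMartingaleProblem L P ℱ ν₀ X) {k : ℕ} {T : ℝ≥0} {B C : ℝ}
    (hB : ∀ t ≤ T, Integrable (fun ω => 1 + ((X t ω).mass : ℝ) ^ k) P ∧
      ∫ ω, (1 + ((X t ω).mass : ℝ) ^ k) ∂P ≤ B)
    {h : FiniteMeasure K → ℝ} (hh : Continuous h) (hle : ∀ ν, |h ν| ≤ C * (1 + (ν.mass : ℝ) ^ k))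
    {s t : ℝ≥0} (hst : s ≤ t) (ht : t ≤ T) :
    Integrable (fun ω => ∫ r in (s : ℝ)..t, h (X r.toNNReal ω)) P := by
  have h1 := (hX.integrable_uncurry hB hh hle).2
  have h2 : Integrable (fun p : ℝ × Ω => h (X p.1.toNNReal p.2))
      ((volume.restrict (Ioc (s : ℝ) t)).prod P) := by
    refine h1.mono_measure (Measure.prod_mono (Measure.restrict_mono ?_ le_rfl) le_rfl)
    exact Ioc_subset_Ioc s.coe_nonneg (NNReal.coe_le_coe.mpr ht)
  simp only [intervalIntegral.integral_of_le (NNReal.coe_le_coe.mpr hst)]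
  exact h2.integral_prod_right

/-- Split at `x = C / ε`: beyond it the higher power absorbs `C * x ^ d`, below it `x ^ d` is
bounded. -/
theorem exists_mul_le_mul_pow_add {C ε : ℝ} (hC : 0 ≤ C) (hε : 0 < ε) (d : ℕ) :
    ∃ B : ℝ, 0 ≤ B ∧ ∀ x : ℝ, 0 ≤ x → C * (1 + x ^ d) ≤ ε * x ^ (d + 1) + B := by
  refine ⟨C + C * (C / ε) ^ d, by positivity, fun x hx => ?_⟩
  have hxd : 0 ≤ x ^ d := by positivity
  rcases le_total (C / ε) x with h | h
  · have h1 : C ≤ ε * x := by rwa [div_le_iff₀' hε] at h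
    have h2 := mul_le_mul_of_nonneg_right h1 hxd
    have h3 : 0 ≤ C * (C / ε) ^ d := by positivity
    calc C * (1 + x ^ d) = C + C * x ^ d := by ring
      _ ≤ C + ε * x * x ^ d := by linarith
      _ ≤ _ := by rw [pow_succ']; linarith
  · have h1 : x ^ d ≤ (C / ε) ^ d := pow_le_pow_left₀ hx h d
    have h2 := mul_le_mul_of_nonneg_left h1 hC
    have h3 : 0 ≤ ε * x ^ (d + 1) := by positivity
    linarith

/-- The perturbation p + ε mass^(d+1) is bounded below, and its drift is bounded above by a multiple
of 1 + mass^(d+1). The compensated process is therefore bounded below by an integrable variable on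
the whole time interval and is a supermartingale, without any maximal inequality; then ε → 0. -/
theorem SolvesMartingaleProblem.setIntegral_mgProcess_le
    (hX : SolvesMartingaleProblem L P ℱ ν₀ X) (hL : IsPolynomialOperator D S L)
    (hD1 : (1 : C(K, ℝ)) ∈ D)
    (hmass : ∀ k, ∃ C : ℝ, 0 ≤ C ∧ ∀ ν : FiniteMeasure K,
      |(L (massPow hD1 k) : SignedMeasure K → ℝ) (toSigned ν)| ≤ C * (1 + (ν.mass : ℝ) ^ k))
    {p : cylDomain D} {d : ℕ} {C : ℝ} (hC : 0 ≤ C)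
    (hpc : Continuous fun ν : FiniteMeasure K => (p : SignedMeasure K → ℝ) (toSigned ν))
    (hLpc : Continuous fun ν : FiniteMeasure K => (L p : SignedMeasure K → ℝ) (toSigned ν))
    (hp : ∀ ν : FiniteMeasure K, |(p : SignedMeasure K → ℝ) (toSigned ν)| ≤
      C * (1 + (ν.mass : ℝ) ^ d))
    (hLp : ∀ ν : FiniteMeasure K, |(L p : SignedMeasure K → ℝ) (toSigned ν)| ≤
      C * (1 + (ν.mass : ℝ) ^ d))
    {s t : ℝ≥0} (hst : s ≤ t) {A : Set Ω} (hA : MeasurableSet[ℱ s] A) :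
    ∫ ω in A, mgProcess (p : SignedMeasure K → ℝ) (L p : SignedMeasure K → ℝ) X t ω ∂P ≤
      ∫ ω in A, mgProcess (p : SignedMeasure K → ℝ) (L p : SignedMeasure K → ℝ) X s ω ∂P := by
  obtain ⟨B, hB0, hB⟩ := hX.exists_integral_mass_pow_le hD1 hmass (d + 1) t
  obtain ⟨C₁, hC₁, hLh⟩ := hmass (d + 1)
  set h : cylDomain D := massPow hD1 (d + 1) with hh
  have hhval (ν : FiniteMeasure K) :
      (h : SignedMeasure K → ℝ) (toSigned ν) = (ν.mass : ℝ) ^ (d + 1) := massPow_toSigned hD1 _ ν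
  have hhc : Continuous fun ν : FiniteMeasure K => (h : SignedMeasure K → ℝ) (toSigned ν) := by
    simp only [hhval]
    exact continuous_mass_pow _
  have hLhc : Continuous fun ν : FiniteMeasure K => (L h : SignedMeasure K → ℝ) (toSigned ν) :=
    hL.continuous_toSigned h (Submodule.subset_span (linPair_pow_mem_cylPoly hD1 _))
  have hup {ν : FiniteMeasure K} {y : ℝ} (hy : y ≤ C * (1 + (ν.mass : ℝ) ^ d)) :
      y ≤ 2 * C * (1 + (ν.mass : ℝ) ^ (d + 1)) := by
    have h1 := pow_le_one_add_pow (NNReal.coe_nonneg ν.mass) (Nat.le_succ d)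
    have h2 : 0 ≤ (ν.mass : ℝ) ^ (d + 1) := by positivity
    have h3 := mul_le_mul_of_nonneg_left h1 hC
    have h4 := mul_nonneg hC h2
    change C * (ν.mass : ℝ) ^ d ≤ C * (1 + (ν.mass : ℝ) ^ (d + 1)) at h3
    nlinarith
  have hmgint {f : cylDomain D} {c : ℝ}
      (hfc : Continuous fun ν : FiniteMeasure K => (f : SignedMeasure K → ℝ) (toSigned ν))
      (hLfc : Continuous fun ν : FiniteMeasure K => (L f : SignedMeasure K → ℝ) (toSigned ν))
      (hf : ∀ ν : FiniteMeasure K, |(f : SignedMeasure K → ℝ) (toSigned ν)| ≤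
        c * (1 + (ν.mass : ℝ) ^ (d + 1)))
      (hLf : ∀ ν : FiniteMeasure K, |(L f : SignedMeasure K → ℝ) (toSigned ν)| ≤
        c * (1 + (ν.mass : ℝ) ^ (d + 1))) (r : ℝ≥0) (hr : r ≤ t) :
      Integrable (mgProcess (f : SignedMeasure K → ℝ) (L f : SignedMeasure K → ℝ) X r) P := by
    have h1 := (hX.integrable_uncurry hB hfc hf).1
    exact ((h1 r hr).sub (h1 0 zero_le)).sub
      (hX.integrable_intervalIntegral hB hLfc hLf (zero_le (a := r)) hr)
  have hpint := hmgint hpc hLpc (fun ν => hup (hp ν)) fun ν => hup (hLp ν)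
  have hhint := hmgint (c := 1 + C₁) hhc hLhc (fun ν => by
      have : 0 ≤ (ν.mass : ℝ) ^ (d + 1) := by positivity
      rw [hhval, abs_of_nonneg this]
      nlinarith [mul_nonneg hC₁ this]) fun ν => (hLh ν).trans (by
      have : 0 ≤ (ν.mass : ℝ) ^ (d + 1) := by positivity
      nlinarith)
  have hstep (ε : ℝ) (hε : 0 < ε) :
      ∫ ω in A, mgProcess (p : SignedMeasure K → ℝ) (L p : SignedMeasure K → ℝ) X t ω ∂P +
      ε * ∫ ω in A, mgProcess (h : SignedMeasure K → ℝ) (L h : SignedMeasure K → ℝ) X t ω ∂P ≤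
      ∫ ω in A, mgProcess (p : SignedMeasure K → ℝ) (L p : SignedMeasure K → ℝ) X s ω ∂P +
      ε * ∫ ω in A, mgProcess (h : SignedMeasure K → ℝ) (L h : SignedMeasure K → ℝ) X s ω ∂P := by
    obtain ⟨B₁, hB₁, hle⟩ := exists_mul_le_mul_pow_add hC hε d
    set G : cylDomain D := p + ε • h with hG
    have hGval (ν : SignedMeasure K) : (G : SignedMeasure K → ℝ) ν =
        (p : SignedMeasure K → ℝ) ν + ε * (h : SignedMeasure K → ℝ) ν := rfl
    have hLGval (ν : SignedMeasure K) : (L G : SignedMeasure K → ℝ) ν =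
        (L p : SignedMeasure K → ℝ) ν + ε * (L h : SignedMeasure K → ℝ) ν := by
      rw [hG, map_add, map_smul]; rfl
    have hGlow (ν : FiniteMeasure K) : -B₁ ≤ (G : SignedMeasure K → ℝ) (toSigned ν) := by
      rw [hGval, hhval]
      have h1 := hle ν.mass (NNReal.coe_nonneg _)
      have h2 := (abs_le.mp (hp ν)).1
      linarith
    have hmgG : ∀ᵐ ω ∂P, ∀ r, mgProcess (G : SignedMeasure K → ℝ) (L G : SignedMeasure K → ℝ) X r ω =
        mgProcess (p : SignedMeasure K → ℝ) (L p : SignedMeasure K → ℝ) X r ω +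
        ε * mgProcess (h : SignedMeasure K → ℝ) (L h : SignedMeasure K → ℝ) X r ω := by
      filter_upwards [hX.integrable p, hX.integrable h] with ω h1 h2 r
      simp only [mgProcess, hGval, hLGval]
      rw [intervalIntegral.integral_add (h1 r) ((h2 r).const_mul ε),
        intervalIntegral.integral_const_mul]
      ring
    have hGint (r : ℝ≥0) (hr : r ≤ t) :
        Integrable (mgProcess (G : SignedMeasure K → ℝ) (L G : SignedMeasure K → ℝ) X r) P :=
      ((hpint r hr).add ((hhint r hr).const_mul ε)).congr
        (hmgG.mono fun ω hω => (hω r).symm)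
    have hGset (r : ℝ≥0) (hr : r ≤ t) :
        ∫ ω in A, mgProcess (G : SignedMeasure K → ℝ) (L G : SignedMeasure K → ℝ) X r ω ∂P =
        ∫ ω in A, mgProcess (p : SignedMeasure K → ℝ) (L p : SignedMeasure K → ℝ) X r ω ∂P +
        ε * ∫ ω in A, mgProcess (h : SignedMeasure K → ℝ) (L h : SignedMeasure K → ℝ) X r ω ∂P := by
      rw [setIntegral_congr_ae (ℱ.le s _ hA) (hmgG.mono fun ω hω _ => hω r),
        integral_add (hpint r hr).integrableOn ((hhint r hr).const_mul ε).integrableOn,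
        integral_const_mul]
    rw [← hGset t le_rfl, ← hGset s hst]
    set C₂ : ℝ := 2 * C + ε * C₁ with hC₂
    have hLG (ν : FiniteMeasure K) : (L G : SignedMeasure K → ℝ) (toSigned ν) ≤
        C₂ * (1 + (ν.mass : ℝ) ^ (d + 1)) := by
      rw [hLGval, hC₂]
      have h1 := hup ((le_abs_self _).trans (hLp ν))
      have h2 := mul_le_mul_of_nonneg_left ((le_abs_self _).trans (hLh ν)) hε.le
      linarith
    have hC₂0 : 0 ≤ C₂ := by positivity
    have hwc : Continuous fun ν : FiniteMeasure K => C₂ * (1 + (ν.mass : ℝ) ^ (d + 1)) :=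
      continuous_const.mul (continuous_const.add (continuous_mass_pow _))
    -- A lower bound valid for all times up to `t`: `B₁` for the current value, the initial value,
    -- and the nonnegative drift bound integrated over the full interval.
    set R : Ω → ℝ := fun ω => B₁ + |(G : SignedMeasure K → ℝ) (toSigned ν₀)| +
      ∫ r in (0 : ℝ≥0)..t, C₂ * (1 + ((X r.toNNReal ω).mass : ℝ) ^ (d + 1)) with hR
    have hwnn (ν : FiniteMeasure K) : 0 ≤ C₂ * (1 + (ν.mass : ℝ) ^ (d + 1)) := by positivity
    have hRint : Integrable R P := (integrable_const _).add
      (hX.integrable_intervalIntegral hB hwc (C := C₂) (fun ν => (abs_of_nonneg (hwnn ν)).le)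
        (zero_le (a := t)) le_rfl)
    have hR0 : 0 ≤ R := fun ω => by
      have : 0 ≤ ∫ r in ((0 : ℝ≥0) : ℝ)..t, C₂ * (1 + ((X r.toNNReal ω).mass : ℝ) ^ (d + 1)) :=
        intervalIntegral.integral_nonneg t.coe_nonneg fun r _ => hwnn _
      change 0 ≤ R ω
      simp only [hR]
      positivity
    refine setIntegral_le_of_locally_martingale (hX.local_martingale G) hst (hGint s hst)
      (hGint t le_rfl) hRint hR0 ?_ hA
    filter_upwards [hX.initial, hX.integrable G] with ω hω hint r hr
    have hwi (b : ℝ) : IntervalIntegrable (fun r : ℝ => C₂ * (1 + ((X r.toNNReal ω).mass : ℝ) ^ (d + 1)))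
        volume 0 b := ((hX.cadlag ω).comp hwc).intervalIntegrable 0 b
    have h1 : ∫ u in (0 : ℝ)..r, (L G : SignedMeasure K → ℝ) (toSigned (X u.toNNReal ω)) ≤
        ∫ u in (0 : ℝ)..r, C₂ * (1 + ((X u.toNNReal ω).mass : ℝ) ^ (d + 1)) :=
      intervalIntegral.integral_mono_on r.coe_nonneg (hint r) (hwi r) fun u _ => hLG _
    have h2 : ∫ u in (0 : ℝ)..r, C₂ * (1 + ((X u.toNNReal ω).mass : ℝ) ^ (d + 1)) ≤
        ∫ u in (0 : ℝ)..t, C₂ * (1 + ((X u.toNNReal ω).mass : ℝ) ^ (d + 1)) :=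
      intervalIntegral.integral_mono_interval le_rfl r.coe_nonneg (NNReal.coe_le_coe.mpr hr)
        (ae_of_all _ fun u => hwnn _) (hwi t)
    have h3 := hGlow (X r ω)
    have h4 := le_abs_self ((G : SignedMeasure K → ℝ) (toSigned ν₀))
    simp only [mgProcess, hR, hω, NNReal.coe_zero]
    linarith
  set a := ∫ ω in A, mgProcess (p : SignedMeasure K → ℝ) (L p : SignedMeasure K → ℝ) X t ω ∂P
  set b := ∫ ω in A, mgProcess (p : SignedMeasure K → ℝ) (L p : SignedMeasure K → ℝ) X s ω ∂P
  set a' := ∫ ω in A, mgProcess (h : SignedMeasure K → ℝ) (L h : SignedMeasure K → ℝ) X t ω ∂P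
  set b' := ∫ ω in A, mgProcess (h : SignedMeasure K → ℝ) (L h : SignedMeasure K → ℝ) X s ω ∂P
  have hlim (x y : ℝ) : Tendsto (fun ε : ℝ => x + ε * y) (𝓝[>] 0) (𝓝 x) := by
    have : Continuous fun ε : ℝ => x + ε * y := by fun_prop
    simpa using (this.tendsto 0).mono_left nhdsWithin_le_nhds
  exact le_of_tendsto_of_tendsto (hlim a a') (hlim b b')
    (by filter_upwards [self_mem_nhdsWithin] with ε hε using hstep ε hε)

/-- For a function of polynomial growth the compensated process is a martingale; stated in
integrated form. -/
theorem SolvesMartingaleProblem.setIntegral_sub_sub_eq_zero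
    (hX : SolvesMartingaleProblem L P ℱ ν₀ X) (hL : IsPolynomialOperator D S L)
    (hD1 : (1 : C(K, ℝ)) ∈ D)
    (hmass : ∀ k, ∃ C : ℝ, 0 ≤ C ∧ ∀ ν : FiniteMeasure K,
      |(L (massPow hD1 k) : SignedMeasure K → ℝ) (toSigned ν)| ≤ C * (1 + (ν.mass : ℝ) ^ k))
    {p : cylDomain D} {d : ℕ} {C : ℝ} (hC : 0 ≤ C)
    (hpc : Continuous fun ν : FiniteMeasure K => (p : SignedMeasure K → ℝ) (toSigned ν))
    (hLpc : Continuous fun ν : FiniteMeasure K => (L p : SignedMeasure K → ℝ) (toSigned ν))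
    (hp : ∀ ν : FiniteMeasure K, |(p : SignedMeasure K → ℝ) (toSigned ν)| ≤
      C * (1 + (ν.mass : ℝ) ^ d))
    (hLp : ∀ ν : FiniteMeasure K, |(L p : SignedMeasure K → ℝ) (toSigned ν)| ≤
      C * (1 + (ν.mass : ℝ) ^ d))
    {s t : ℝ≥0} (hst : s ≤ t) {A : Set Ω} (hA : MeasurableSet[ℱ s] A) :
    ∫ ω in A, ((p : SignedMeasure K → ℝ) (toSigned (X t ω)) -
      (p : SignedMeasure K → ℝ) (toSigned (X s ω)) -
      ∫ r in (s : ℝ)..t, (L p : SignedMeasure K → ℝ) (toSigned (X r.toNNReal ω))) ∂P = 0 := by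
  obtain ⟨B, hB0, hB⟩ := hX.exists_integral_mass_pow_le hD1 hmass d t
  have h1 := (hX.integrable_uncurry hB hpc hp).1
  have hint (r : ℝ≥0) (hr : r ≤ t) :
      Integrable (mgProcess (p : SignedMeasure K → ℝ) (L p : SignedMeasure K → ℝ) X r) P :=
    ((h1 r hr).sub (h1 0 zero_le)).sub
      (hX.integrable_intervalIntegral hB hLpc hLp (zero_le (a := r)) hr)
  have hle := hX.setIntegral_mgProcess_le hL hD1 hmass hC hpc hLpc hp hLp hst hA
  -- The hypotheses are symmetric in sign, so `-p` supplies the reverse inequality.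
  have hge := hX.setIntegral_mgProcess_le hL hD1 hmass (p := -p) hC hpc.neg
    (by rw [map_neg]; exact hLpc.neg) (fun ν => by
      have := hp ν
      rw [← abs_neg] at this
      exact this) (fun ν => by
      have := hLp ν
      rw [← abs_neg] at this
      rw [map_neg]
      exact this) hst hA
  have hneg (r : ℝ≥0) (ω : Ω) : mgProcess ((-p : cylDomain D) : SignedMeasure K → ℝ)
      (L (-p) : SignedMeasure K → ℝ) X r ω =
      -(mgProcess (p : SignedMeasure K → ℝ) (L p : SignedMeasure K → ℝ) X r ω) := by
    have h2 (ν : SignedMeasure K) : (L (-p) : SignedMeasure K → ℝ) ν =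
      -(L p : SignedMeasure K → ℝ) ν := by rw [map_neg]; rfl
    have h3 (ν : SignedMeasure K) : ((-p : cylDomain D) : SignedMeasure K → ℝ) ν =
      -(p : SignedMeasure K → ℝ) ν := rfl
    simp only [mgProcess, h2, h3, intervalIntegral.integral_neg]
    ring
  simp only [hneg, integral_neg] at hge
  have heq : ∫ ω in A, mgProcess (p : SignedMeasure K → ℝ) (L p : SignedMeasure K → ℝ) X t ω ∂P -
      ∫ ω in A, mgProcess (p : SignedMeasure K → ℝ) (L p : SignedMeasure K → ℝ) X s ω ∂P = 0 := by
    linarith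
  rw [← integral_sub (hint t le_rfl).integrableOn (hint s hst).integrableOn] at heq
  rw [← heq]
  refine setIntegral_congr_ae (ℱ.le s _ hA) ?_
  filter_upwards [hX.integrable p] with ω hω _
  have h2 := intervalIntegral.integral_add_adjacent_intervals (hω s)
    ((hω s).symm.trans (hω t))
  simp only [mgProcess]
  linarith

end Solutions

/-! ### Functions of two times with equal partial derivatives -/

section DualityLemma

theorem intervalIntegrable_triangle {f : ℝ → ℝ → ℝ} {t : ℝ} (ht : 0 ≤ t)
    (hf : Integrable (fun p : ℝ × ℝ => f p.1 p.2)
      ((volume.restrict (Ioc 0 t)).prod (volume.restrict (Ioc 0 t)))) :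
    IntervalIntegrable (fun s => ∫ r in (0 : ℝ)..s, f s r) volume 0 t := by
  have hind : Integrable (fun p : ℝ × ℝ => {p : ℝ × ℝ | p.2 ≤ p.1}.indicator (fun p => f p.1 p.2) p)
      ((volume.restrict (Ioc 0 t)).prod (volume.restrict (Ioc 0 t))) :=
    hf.indicator (measurableSet_le measurable_snd measurable_fst)
  rw [intervalIntegrable_iff_integrableOn_Ioc_of_le ht]
  refine Integrable.congr hind.integral_prod_left ?_
  filter_upwards [ae_restrict_mem measurableSet_Ioc] with s hs
  have h1 : (fun r => {p : ℝ × ℝ | p.2 ≤ p.1}.indicator (fun p => f p.1 p.2) (s, r)) =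
      (Iic s).indicator fun r => f s r := by
    ext r
    by_cases h : r ≤ s <;> simp [h]
  simp only [h1]
  rw [integral_indicator measurableSet_Iic, Measure.restrict_restrict measurableSet_Iic,
    intervalIntegral.integral_of_le hs.1.le]
  congr 2
  ext r
  simp only [mem_Ioc, mem_inter_iff, mem_Iic]
  constructor
  · rintro ⟨h, h'⟩; exact ⟨h'.1, h⟩
  · rintro ⟨h, h'⟩; exact ⟨h', h, h'.trans hs.2⟩

/-- A function on `[0, S]` all of whose integrals over `[0, t]` vanish vanishes at `S`, if it is
continuous. -/
theorem eq_zero_of_forall_integral_eq_zero {k : ℝ → ℝ} {S : ℝ} (hS : 0 < S)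
    (hk : ContinuousOn k (Icc 0 S)) (h : ∀ t ∈ Icc 0 S, ∫ a in (0 : ℝ)..t, k a = 0) : k S = 0 := by
  -- The extension, constant outside `[0, S]`, has a two-sided derivative at `S`; it is compared
  -- with the zero derivative from within the interval.
  have hext : Continuous (IccExtend hS.le ((Icc 0 S).domRestrict k)) :=
    continuous_IccExtend_iff.mpr (continuousOn_iff_continuous_domRestrict.mp hk)
  have hd : HasDerivAt (fun t => ∫ a in (0 : ℝ)..t, IccExtend hS.le ((Icc 0 S).domRestrict k) a)
      (IccExtend hS.le ((Icc 0 S).domRestrict k) S) S :=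
    intervalIntegral.integral_hasDerivAt_right (hext.intervalIntegrable _ _)
      (hext.stronglyMeasurableAtFilter _ _) hext.continuousAt
  have hd0 : HasDerivWithinAt
      (fun t => ∫ a in (0 : ℝ)..t, IccExtend hS.le ((Icc 0 S).domRestrict k) a) 0 (Icc 0 S) S := by
    refine (hasDerivWithinAt_const S (Icc 0 S) (0 : ℝ)).congr_of_mem (fun t ht => ?_)
      (right_mem_Icc.mpr hS.le)
    refine Eq.trans (intervalIntegral.integral_congr fun a ha => ?_) (h t ht)
    rw [uIcc_of_le ht.1] at ha
    rw [IccExtend_of_mem hS.le _ ⟨ha.1, ha.2.trans ht.2⟩]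
    rfl
  have := (uniqueDiffOn_Icc hS S (right_mem_Icc.mpr hS.le)).eq_deriv _ hd.hasDerivWithinAt hd0
  rwa [IccExtend_of_mem hS.le _ (right_mem_Icc.mpr hS.le)] at this

/-- A function of two variables whose two partial derivatives agree almost everywhere is constant
along antidiagonals; here only the end points of the antidiagonal are compared. -/
theorem eq_swap_of_partial_integrals_eq {f ψ : ℝ → ℝ → ℝ} {S : ℝ} (hS : 0 ≤ S)
    (h1 : ∀ a ∈ Icc 0 S, ∀ b ∈ Icc 0 S, f a b = f 0 b + ∫ u in (0 : ℝ)..a, ψ u b)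
    (h2 : ∀ a ∈ Icc 0 S, ∀ b ∈ Icc 0 S, f a b = f a 0 + ∫ u in (0 : ℝ)..b, ψ a u)
    (hψ : Integrable (fun p : ℝ × ℝ => ψ p.1 p.2)
      ((volume.restrict (Ioc 0 S)).prod (volume.restrict (Ioc 0 S))))
    (hψ1 : IntervalIntegrable (fun u => ψ u 0) volume 0 S)
    (hψ2 : IntervalIntegrable (fun u => ψ 0 u) volume 0 S) : f S 0 = f 0 S := by
  rcases hS.eq_or_lt with rfl | hS
  · rfl
  have h0 : (0 : ℝ) ∈ Icc 0 S := left_mem_Icc.mpr hS.le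
  have hprim {φ : ℝ → ℝ} (hφ : IntervalIntegrable φ volume 0 S) :
      ContinuousOn (fun a => ∫ u in (0 : ℝ)..a, φ u) (Icc 0 S) := by
    have := intervalIntegral.continuousOn_primitive_interval (a := (0 : ℝ)) (b := S) (f := φ)
      (μ := volume) (by
        rw [uIcc_of_le hS.le]
        exact (intervalIntegrable_iff_integrableOn_Icc_of_le hS.le).mp hφ)
    rwa [uIcc_of_le hS.le] at this
  have hc1 : ContinuousOn (fun a => f a 0) (Icc 0 S) :=
    (continuousOn_const.add (hprim hψ1)).congr fun a ha => h1 a ha 0 h0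
  have hc2 : ContinuousOn (fun b => f 0 b) (Icc 0 S) :=
    (continuousOn_const.add (hprim hψ2)).congr fun b hb => h2 0 h0 b hb
  -- It suffices that `f a 0` and `f 0 a` have the same integral over `[0, t]` for every `t`. Both
  -- arise from integrating `f a (t - a)`, expanded by `h2` and by `h1`; the remaining double
  -- integrals of `ψ` agree by Fubini on the triangle.
  refine sub_eq_zero.mp (eq_zero_of_forall_integral_eq_zero (k := fun a => f a 0 - f 0 a) hS
    (hc1.sub hc2) fun t ht => ?_)
  have hsub : Icc 0 t ⊆ Icc 0 S := Icc_subset_Icc_right ht.2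
  have hi1 : IntervalIntegrable (fun a => f a 0) volume 0 t :=
    ContinuousOn.intervalIntegrable (by rw [uIcc_of_le ht.1]; exact hc1.mono hsub)
  have hi2 : IntervalIntegrable (fun a => f 0 a) volume 0 t :=
    ContinuousOn.intervalIntegrable (by rw [uIcc_of_le ht.1]; exact hc2.mono hsub)
  have hi2' : IntervalIntegrable (fun a => f 0 (t - a)) volume 0 t := by
    have := (hi2.comp_sub_left t).symm
    simpa using this
  have hψt : Integrable (fun p : ℝ × ℝ => ψ p.1 p.2)
      ((volume.restrict (Ioc 0 t)).prod (volume.restrict (Ioc 0 t))) :=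
    hψ.mono_measure (Measure.prod_mono (Measure.restrict_mono (Ioc_subset_Ioc_right ht.2) le_rfl)
      (Measure.restrict_mono (Ioc_subset_Ioc_right ht.2) le_rfl))
  have hmp : MeasurePreserving (fun s : ℝ => t - s) (volume.restrict (Ioc 0 t))
      (volume.restrict (Ioc 0 t)) := by
    have h3 := (volume.measurePreserving_sub_left t).restrict_preimage
      (measurableSet_Ioc (a := (0 : ℝ)) (b := t))
    have h4 : (fun s : ℝ => t - s) ⁻¹' Ioc 0 t = Ico 0 t := by
      ext s
      simp only [mem_preimage, mem_Ioc, mem_Ico]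
      constructor <;> rintro ⟨h, h'⟩ <;> constructor <;> linarith
    rw [h4, Measure.restrict_congr_set Ico_ae_eq_Ioc] at h3
    exact h3
  have hψt' : Integrable (fun p : ℝ × ℝ => ψ p.2 (t - p.1))
      ((volume.restrict (Ioc 0 t)).prod (volume.restrict (Ioc 0 t))) := by
    have h3 := hψt.swap
    exact (hmp.prod (MeasurePreserving.id _)).integrable_comp_of_integrable h3
  have hI1 := intervalIntegrable_triangle (f := fun s r => ψ r (t - s)) ht.1 hψt'
  have hswap := intervalIntegral_triangle_swap (f := fun s r => ψ r (t - s)) ht.1 hψt'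
  have hinner (r : ℝ) : ∫ s in r..t, ψ r (t - s) = ∫ s in (0 : ℝ)..t - r, ψ r s := by
    rw [intervalIntegral.integral_comp_sub_left (fun s => ψ r s) t, sub_self]
  simp only [hinner] at hswap
  have heq : ∀ a ∈ Icc 0 t, ∫ u in (0 : ℝ)..t - a, ψ a u =
      (f 0 (t - a) + ∫ u in (0 : ℝ)..a, ψ u (t - a)) - f a 0 := fun a ha => by
    have hta : t - a ∈ Icc 0 S := ⟨sub_nonneg.mpr ha.2, by linarith [ha.1, ht.2]⟩
    rw [← h1 a (hsub ha) _ hta, h2 a (hsub ha) _ hta]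
    ring
  have hI2 : ∫ a in (0 : ℝ)..t, ∫ u in (0 : ℝ)..t - a, ψ a u =
      (∫ a in (0 : ℝ)..t, f 0 (t - a)) + (∫ a in (0 : ℝ)..t, ∫ u in (0 : ℝ)..a, ψ u (t - a)) -
        ∫ a in (0 : ℝ)..t, f a 0 := by
    rw [← intervalIntegral.integral_add hi2' hI1, ← intervalIntegral.integral_sub (hi2'.add hI1) hi1]
    refine intervalIntegral.integral_congr fun a ha => ?_
    rw [uIcc_of_le ht.1] at ha
    exact heq a ha
  have hrev : ∫ a in (0 : ℝ)..t, f 0 (t - a) = ∫ a in (0 : ℝ)..t, f 0 a := by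
    rw [intervalIntegral.integral_comp_sub_left (fun s => f 0 s) t]
    simp
  rw [intervalIntegral.integral_sub hi1 hi2]
  linarith

end DualityLemma

/-! ### Polynomials with time-dependent coefficients at random measures -/

section JointMeasurability

theorem aestronglyMeasurable_simpleFunc_prod {α β Ω : Type*} [MeasurableSpace α]
    [MeasurableSpace Ω] {ρ : Measure α} {P : Measure Ω} [SFinite ρ] [SFinite P] {F : α → β → ℝ}
    (hF : ∀ b, AEStronglyMeasurable (fun s => F s b) ρ) (φ : SimpleFunc Ω β) :
    AEStronglyMeasurable (fun p : α × Ω => F p.1 (φ p.2)) (ρ.prod P) := by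
  have hsum : (fun p : α × Ω => F p.1 (φ p.2)) = fun p =>
      ∑ b ∈ φ.range, F p.1 b * (φ ⁻¹' {b}).indicator (fun _ => (1 : ℝ)) p.2 := by
    ext p
    rw [Finset.sum_eq_single (φ p.2)]
    · rw [indicator_of_mem (show p.2 ∈ φ ⁻¹' {φ p.2} from rfl), mul_one]
    · intro b _ hb
      rw [indicator_of_notMem (fun h : p.2 ∈ φ ⁻¹' {b} => hb (Eq.symm h)), mul_zero]
    · intro h
      exact absurd (SimpleFunc.mem_range_self _ _) h
  rw [hsum]
  refine Finset.aestronglyMeasurable_fun_sum _ fun b _ => ?_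
  exact (hF b).comp_fst.mul (((stronglyMeasurable_const.indicator
    (SimpleFunc.measurableSet_fiber _ _)).aestronglyMeasurable).comp_snd)

variable {K : Type*} [TopologicalSpace K] [CompactSpace K] [T2Space K] [MeasurableSpace K]
  [BorelSpace K] {m : ℕ} {α Ω : Type*} [MeasurableSpace α] [MeasurableSpace Ω]
  {ρ : Measure α} {P : Measure Ω} [SFinite ρ] [SFinite P] {H : α → Coeff K m}
  {ξ : Ω → FiniteMeasure K}

/-- A Carathéodory argument: the integrand is measurable in `s` and continuous in the measure, so
`ξ` may be approximated by simple functions. -/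
theorem aestronglyMeasurable_poly
    (hH : ∀ ν : FiniteMeasure K, AEStronglyMeasurable (fun s => poly (H s) ν) ρ)
    (hξ : StronglyMeasurable ξ) :
    AEStronglyMeasurable (fun p : α × Ω => poly (H p.1) (ξ p.2)) (ρ.prod P) := by
  have happ (n : ℕ) : AEStronglyMeasurable (fun p : α × Ω => poly (H p.1) (hξ.approx n p.2))
      (ρ.prod P) :=
    aestronglyMeasurable_simpleFunc_prod (F := fun s ν => poly (H s) ν) hH (hξ.approx n)
  have hlim (p : α × Ω) : Tendsto (fun n => poly (H p.1) (hξ.approx n p.2)) atTop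
      (𝓝 (poly (H p.1) (ξ p.2))) := by
    have h1 := hξ.tendsto_approx p.2
    have h2 := (continuous_poly (H p.1)).tendsto (ξ p.2)
    exact h2.comp h1
  exact aestronglyMeasurable_of_tendsto_ae atTop happ (ae_of_all _ hlim)

/-- Joint integrability of `⟨H s, ξ⟩` under the uniform bound on the time integral. -/
theorem integrable_poly_prod {C : ℝ}
    (hH : ∀ ν : FiniteMeasure K, Integrable (fun s => poly (H s) ν) ρ) (hξ : StronglyMeasurable ξ)
    (hC : ∀ ν : FiniteMeasure K, ∫ s, |poly (H s) ν| ∂ρ ≤ C * (1 + (ν.mass : ℝ) ^ m))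
    (hint : Integrable (fun ω => 1 + ((ξ ω).mass : ℝ) ^ m) P) :
    Integrable (fun p : α × Ω => poly (H p.1) (ξ p.2)) (ρ.prod P) ∧
    ∫ p, |poly (H p.1) (ξ p.2)| ∂(ρ.prod P) ≤ C * ∫ ω, (1 + ((ξ ω).mass : ℝ) ^ m) ∂P := by
  have hmeas := aestronglyMeasurable_poly (P := P) (fun ν => (hH ν).1) hξ
  have h1 : Integrable (fun p : α × Ω => poly (H p.1) (ξ p.2)) (ρ.prod P) := by
    refine (integrable_prod_iff' hmeas).mpr ⟨ae_of_all _ fun ω => hH (ξ ω), ?_⟩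
    refine (hint.const_mul C).mono' hmeas.norm.prod_swap.integral_prod_right'
      (ae_of_all _ fun ω => ?_)
    rw [Real.norm_of_nonneg (integral_nonneg fun _ => norm_nonneg _)]
    exact hC (ξ ω)
  refine ⟨h1, ?_⟩
  rw [integral_prod_symm _ h1.abs, ← integral_const_mul]
  exact integral_mono h1.abs.integral_prod_right (hint.const_mul C) fun ω => hC (ξ ω)

end JointMeasurability

/-- The identity is a closed condition on pairs, so it passes from the graph to its closure, which
by closability is the graph of the closure. -/
theorem eq_map_closure_of_isClosable {V W : Type*} [NormedAddCommGroup V] [NormedSpace ℝ V]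
    [NormedAddCommGroup W] [NormedSpace ℝ W] {A : V →ₗ.[ℝ] W} (hcl : A.IsClosable)
    {Φ : V →ₗ[ℝ] ℝ} {Ψ : W →ₗ[ℝ] ℝ} (hΦ : Continuous Φ) (hΨ : Continuous Ψ)
    (h : ∀ g : A.domain, Φ g = Ψ (A g)) (g : A.closure.domain) : Φ g = Ψ (A.closure g) := by
  have hclosed : IsClosed {p : V × W | Φ p.1 = Ψ p.2} :=
    isClosed_eq (hΦ.comp continuous_fst) (hΨ.comp continuous_snd)
  have hsub : (A.graph : Set (V × W)) ⊆ {p | Φ p.1 = Ψ p.2} := by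
    rintro p hp
    obtain ⟨x, hx, hx'⟩ := (LinearPMap.mem_graph_iff A).mp hp
    rw [mem_ofPred_eq, ← hx, ← hx']
    exact h x
  have hmem : ((g : V), A.closure g) ∈ A.graph.topologicalClosure := by
    rw [hcl.graph_closure_eq_closure_graph]
    exact A.closure.mem_graph g
  exact closure_minimal hsub hclosed hmem

/-! ### Integration as a continuous functional of the coefficients -/

section Functionals

variable {K : Type*} [TopologicalSpace K] [CompactSpace K] [T2Space K] [MeasurableSpace K]
  [BorelSpace K] {m : ℕ} {α : Type*} [MeasurableSpace α] {μ : Measure α} {ζ : α → FiniteMeasure K}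

/-- Integration of `⟨g, ζ⟩` is a continuous linear functional of the coefficient vector `g`, if
`ζ` has enough moments. -/
theorem exists_continuous_integral_poly
    (hm : ∀ g : Coeff K m, AEStronglyMeasurable (fun a => poly g (ζ a)) μ)
    (hint : Integrable (fun a => 1 + ((ζ a).mass : ℝ) ^ m) μ) :
    ∃ Φ : Coeff K m →ₗ[ℝ] ℝ, Continuous Φ ∧ ∀ g, Φ g = ∫ a, poly g (ζ a) ∂μ := by
  have hi (g : Coeff K m) : Integrable (fun a => poly g (ζ a)) μ :=
    (hint.const_mul ((m + 1) * ‖g‖)).mono' (hm g) (ae_of_all _ fun a => abs_poly_le g (ζ a))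
  let Φ : Coeff K m →ₗ[ℝ] ℝ :=
    { toFun := fun g => ∫ a, poly g (ζ a) ∂μ
      map_add' := fun g h => by
        simp only [poly_add]
        exact integral_add (hi g) (hi h)
      map_smul' := fun c g => by
        simp only [poly_smul]
        exact integral_const_mul c _ }
  refine ⟨Φ, AddMonoidHomClass.continuous_of_bound Φ
    ((m + 1) * ∫ a, (1 + ((ζ a).mass : ℝ) ^ m) ∂μ) fun g => ?_, fun g => rfl⟩
  calc ‖Φ g‖ ≤ ∫ a, (m + 1) * ‖g‖ * (1 + ((ζ a).mass : ℝ) ^ m) ∂μ :=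
        norm_integral_le_of_norm_le (hint.const_mul _) (ae_of_all _ fun a => abs_poly_le g (ζ a))
    _ = _ := by rw [integral_const_mul]; exact mul_right_comm _ _ _

end Functionals

theorem integral_norm_le_of_lintegral_enorm_le {α F : Type*} [MeasurableSpace α]
    [NormedAddCommGroup F] {μ : Measure α} {f : α → F} {c : ℝ} (hc : 0 ≤ c)
    (hf : AEStronglyMeasurable f μ)     (h : ∫⁻ a, ‖f a‖ₑ ∂μ ≤ ENNReal.ofReal c) : ∫ a, ‖f a‖ ∂μ ≤ c := by
  rw [integral_norm_eq_lintegral_enorm hf]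
  exact ENNReal.toReal_le_of_le_ofReal hc h

/-! ### The duality argument -/

section Duality

variable {E : Type*} [TopologicalSpace E] [T2Space E] [LocallyCompactSpace E] [MeasurableSpace E]
  [BorelSpace E] {D : Submodule ℝ C(EDelta E, ℝ)}
  {L : cylDomain D →ₗ[ℝ] measurableMaps (EDelta E)} {m : ℕ}
  {Lm : Coeff (EDelta E) m →ₗ.[ℝ] Coeff (EDelta E) m}
  {Ω : Type*} [mΩ : MeasurableSpace Ω] {P : Measure Ω} [IsProbabilityMeasure P]
  {ℱ : Filtration ℝ≥0 mΩ} {ν₀ : FiniteMeasure (EDelta E)} {X : ℝ≥0 → Ω → FiniteMeasure (EDelta E)}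

theorem SolvesMartingaleProblem.integrable_prod_restrict {K : Type*} [TopologicalSpace K]
    [CompactSpace K] [T2Space K] [MeasurableSpace K] [BorelSpace K] {D : Submodule ℝ C(K, ℝ)}
    {L : cylDomain D →ₗ[ℝ] measurableMaps K} {ν₀ : FiniteMeasure K} {X : ℝ≥0 → Ω → FiniteMeasure K}
    (hX : SolvesMartingaleProblem L P ℱ ν₀ X) {k : ℕ} {T : ℝ≥0} {B C : ℝ}
    (hB : ∀ t ≤ T, Integrable (fun ω => 1 + ((X t ω).mass : ℝ) ^ k) P ∧
      ∫ ω, (1 + ((X t ω).mass : ℝ) ^ k) ∂P ≤ B)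
    {h : FiniteMeasure K → ℝ} (hh : Continuous h) (hle : ∀ ν, |h ν| ≤ C * (1 + (ν.mass : ℝ) ^ k))
    (s : ℝ≥0) {t : ℝ≥0} (ht : t ≤ T) (A : Set Ω) :
    Integrable (fun p : ℝ × Ω => h (X p.1.toNNReal p.2))
      ((volume.restrict (Ioc (s : ℝ) t)).prod (P.restrict A)) :=
  (hX.integrable_uncurry hB hh hle).2.mono_measure (Measure.prod_mono (Measure.restrict_mono
    (Ioc_subset_Ioc s.coe_nonneg (NNReal.coe_le_coe.mpr ht)) le_rfl) Measure.restrict_le_self)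

/-- Integrability of `⟨H s, (X (t + r))⟩` in the time variables `r`, `s` and in `ω`. -/
theorem SolvesMartingaleProblem.integrable_poly_triple {K : Type*} [TopologicalSpace K]
    [CompactSpace K] [T2Space K] [MeasurableSpace K] [BorelSpace K] {D : Submodule ℝ C(K, ℝ)}
    {L : cylDomain D →ₗ[ℝ] measurableMaps K} {ν₀ : FiniteMeasure K} {X : ℝ≥0 → Ω → FiniteMeasure K}
    (hX : SolvesMartingaleProblem L P ℱ ν₀ X) {m : ℕ} {H : ℝ → Coeff K m} {t S : ℝ≥0}
    {B C : ℝ} (hC : 0 ≤ C) (A : Set Ω) {ρ : Measure ℝ} [SFinite ρ]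
    (hB : ∀ r ≤ t + S, Integrable (fun ω => 1 + ((X r ω).mass : ℝ) ^ m) P ∧
      ∫ ω, (1 + ((X r ω).mass : ℝ) ^ m) ∂P ≤ B)
    (hH : ∀ ν, Integrable (fun s => poly (H s) ν) ρ)
    (hCle : ∀ ν : FiniteMeasure K, ∫ s, |poly (H s) ν| ∂ρ ≤ C * (1 + (ν.mass : ℝ) ^ m)) :
    Integrable (fun p : ℝ × ℝ => ∫ ω in A, poly (H p.1) (X (t + p.2.toNNReal) ω) ∂P)
      (ρ.prod (volume.restrict (Ioc (0 : ℝ) S))) := by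
  have hsm (r : ℝ≥0) : StronglyMeasurable (X r) := (hX.adapted r).mono (ℱ.le r)
  -- Right-continuity holds in `r`, so `r` is the first variable and the pair `(s, ω)` is treated as
  -- one parameter.
  have hmeas : AEStronglyMeasurable
      (fun p : ℝ × ℝ × Ω => poly (H p.2.1) (X (t + p.1.toNNReal) p.2.2))
      ((volume.restrict (Ioc (0 : ℝ) S)).prod (ρ.prod (P.restrict A))) :=
    aestronglyMeasurable_uncurry_of_rightContinuous
      (Y := fun r (q : ℝ × Ω) => poly (H q.1) (X (t + r) q.2))
      (fun r => aestronglyMeasurable_poly (fun ν => (hH ν).1) (hsm _))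
      (ae_of_all _ fun q r => (continuous_poly _).continuousAt.comp_continuousWithinAt
        (((hX.cadlag q.2 (t + r)).1).comp (continuous_const.add continuous_id).continuousWithinAt
          fun u hu => add_le_add_right (mem_Ici.mp hu) t))
  have htriple : Integrable (fun p : ℝ × ℝ × Ω => poly (H p.2.1) (X (t + p.1.toNNReal) p.2.2))
      ((volume.restrict (Ioc (0 : ℝ) S)).prod (ρ.prod (P.restrict A))) := by
    have hle (r : ℝ) (hr : r ∈ Ioc (0 : ℝ) S) := by
      have hr' : t + r.toNNReal ≤ t + S := add_le_add_right (Real.toNNReal_le_iff_le_coe.mpr hr.2) t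
      exact And.intro (integrable_poly_prod hH (hsm (t + r.toNNReal)) hCle
        ((hB _ hr').1.restrict (s := A)))
        ((setIntegral_le_integral (s := A) (hB _ hr').1 (ae_of_all _ fun ω => (by positivity :
          0 ≤ 1 + ((X (t + r.toNNReal) ω).mass : ℝ) ^ m))).trans (hB _ hr').2)
    refine (integrable_prod_iff hmeas).mpr ⟨?_, ?_⟩
    · filter_upwards [ae_restrict_mem measurableSet_Ioc] with r hr using (hle r hr).1.1
    · refine (integrable_const (C * B)).mono' hmeas.norm.integral_prod_right' ?_
      filter_upwards [ae_restrict_mem measurableSet_Ioc] with r hr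
      rw [Real.norm_of_nonneg (integral_nonneg fun _ => norm_nonneg _)]
      exact (hle r hr).1.2.trans (mul_le_mul_of_nonneg_left (hle r hr).2 hC)
  have hassoc := ((measurePreserving_prodAssoc (volume.restrict (Ioc (0 : ℝ) S)) ρ
    (P.restrict A)).integrable_comp_of_integrable htriple).integral_prod_left
  exact hassoc.swap

/-- The martingale property, extended to the closure of the dual operator. -/
theorem SolvesMartingaleProblem.setIntegral_poly_closure
    (hX : SolvesMartingaleProblem L P ℱ ν₀ X) (hL : IsPolynomialOperator D (MPlus E) L)
    (hD1 : (1 : C(EDelta E, ℝ)) ∈ D) (hLm : IsDualOperator D (MPlus E) L m Lm)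
    (hcl : Lm.IsClosable) {T : ℝ≥0} {B : ℝ}
    (hB : ∀ t ≤ T, Integrable (fun ω => 1 + ((X t ω).mass : ℝ) ^ m) P ∧
      ∫ ω, (1 + ((X t ω).mass : ℝ) ^ m) ∂P ≤ B)
    {s t : ℝ≥0} (hst : s ≤ t) (ht : t ≤ T) {A : Set Ω} (hA : MeasurableSet[ℱ s] A)
    (g : Lm.closure.domain) :
    ∫ ω in A, poly (g : Coeff (EDelta E) m) (X t ω) ∂P =
      (∫ ω in A, poly (g : Coeff (EDelta E) m) (X s ω) ∂P) +
        ∫ r in (s : ℝ)..t, ∫ ω in A, poly (Lm.closure g) (X r.toNNReal ω) ∂P := by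
  have hpt (r : ℝ≥0) (hr : r ≤ T) :
      ∃ Φ : Coeff (EDelta E) m →ₗ[ℝ] ℝ, Continuous Φ ∧
        ∀ g, Φ g = ∫ ω in A, poly g (X r ω) ∂P :=
    exists_continuous_integral_poly (fun g => ((hX.stronglyMeasurable_comp
      (continuous_poly g) r).mono (ℱ.le r)).aestronglyMeasurable) (hB r hr).1.restrict
  have hfub (g : Coeff (EDelta E) m) := hX.integrable_prod_restrict hB (continuous_poly g)
    (abs_poly_le g) s ht A
  have hmass := hX.integrable_prod_restrict hB
    (continuous_const.add (continuous_mass_pow (K := EDelta E) m) :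
      Continuous fun ν : FiniteMeasure (EDelta E) => 1 + (ν.mass : ℝ) ^ m)
    (C := 1) (fun ν => by
      have h : 0 ≤ 1 + (ν.mass : ℝ) ^ m := by positivity
      rw [one_mul]
      exact (abs_of_nonneg h).le) s ht A
  obtain ⟨Φt, hΦt, ht'⟩ := hpt t ht
  obtain ⟨Φs, hΦs, hs'⟩ := hpt s (hst.trans ht)
  -- The time integral and the expectation are taken together, as one integral over the product
  -- space, to obtain a single continuous functional of the image coefficient.
  obtain ⟨Ψ, hΨ, hΨ'⟩ := exists_continuous_integral_poly (m := m)
    (ζ := fun p : ℝ × Ω => X p.1.toNNReal p.2) (fun g => (hfub g).1) hmass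
  have hint (r : ℝ≥0) (hr : r ≤ T) (g : Coeff (EDelta E) m) :
      Integrable (fun ω => poly g (X r ω)) (P.restrict A) :=
    ((hX.integrable_uncurry hB (continuous_poly g) (abs_poly_le g)).1 r hr).restrict
  have key := eq_map_closure_of_isClosable hcl (Φ := Φt - Φs) (Ψ := Ψ) (hΦt.sub hΦs) hΨ (fun g => by
    obtain ⟨p, hp, hpg, hLp⟩ := IsDualOperator.apply_toSigned hL hLm g
    set C : ℝ := (m + 1) * (‖(g : Coeff (EDelta E) m)‖ + ‖Lm g‖) with hC
    have h1 := hX.setIntegral_sub_sub_eq_zero hL hD1 (hL.exists_abs_massPow_le hD1) (p := p)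
      (d := m) (C := C) (by positivity) (by simpa only [hpg] using continuous_poly _)
      (by simpa only [hLp] using continuous_poly _)
      (fun ν => by
        rw [hpg]
        refine (abs_poly_le _ ν).trans ?_
        rw [hC]
        gcongr
        exact le_add_of_nonneg_right (norm_nonneg _))
      (fun ν => by
        rw [hLp]
        refine (abs_poly_le _ ν).trans ?_
        rw [hC]
        gcongr
        exact le_add_of_nonneg_left (norm_nonneg _)) hst hA
    simp only [hpg, hLp] at h1
    have hsub : Integrable (fun ω => poly (g : Coeff (EDelta E) m) (X t ω) -
        poly (g : Coeff (EDelta E) m) (X s ω)) (P.restrict A) :=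
      (hint t ht _).sub (hint s (hst.trans ht) _)
    rw [integral_sub hsub
      (hX.integrable_intervalIntegral hB (continuous_poly _) (abs_poly_le _) hst ht).restrict,
      integral_sub (hint t ht _) (hint s (hst.trans ht) _)] at h1
    rw [LinearMap.sub_apply, ht', hs', hΨ', integral_prod_symm _ (hfub _)]
    simp only [intervalIntegral.integral_of_le (NNReal.coe_le_coe.mpr hst)] at h1
    linarith) g
  rw [LinearMap.sub_apply, ht', hs', hΨ', integral_prod _ (hfub _)] at key
  rw [intervalIntegral.integral_of_le (NNReal.coe_le_coe.mpr hst)]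
  linarith

/-- The two-time function pairs the dual solution at time `a` with `X` at time `t + b`. Both of its
derivatives are the pairing with the image of `g a` under the closed dual operator. -/
theorem SolvesMartingaleProblem.setIntegral_poly_weakSolution
    (hX : SolvesMartingaleProblem L P ℱ ν₀ X) (hL : IsPolynomialOperator D (MPlus E) L)
    (hD1 : (1 : C(EDelta E, ℝ)) ∈ D) (hLm : IsDualOperator D (MPlus E) L m Lm)
    (hcl : Lm.IsClosable) {t S : ℝ≥0} {g₀ : Lm.closure.domain} {g : ℝ → Lm.closure.domain}
    (hg : IsWeakSolution Lm.closure ((t + S : ℝ≥0) : ℝ) g₀ g) {A : Set Ω}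
    (hA : MeasurableSet[ℱ t] A) :
    ∫ ω in A, poly (g S : Coeff (EDelta E) m) (X t ω) ∂P =
      ∫ ω in A, poly (g₀ : Coeff (EDelta E) m) (X (t + S) ω) ∂P := by
  obtain ⟨B, hB0, hB⟩ := hX.exists_integral_mass_pow_le hD1 (hL.exists_abs_massPow_le hD1) m (t + S)
  set H : ℝ → Coeff (EDelta E) m := fun s => Lm.closure (g s) with hHdef
  set ρ : Measure ℝ := volume.restrict (Ioc (0 : ℝ) S) with hρ
  have hSle : (S : ℝ) ≤ (t + S : ℝ≥0) := by
    rw [NNReal.coe_add]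
    exact le_add_of_nonneg_left t.coe_nonneg
  have hH (ν : FiniteMeasure (EDelta E)) : Integrable (fun s => poly (H s) ν) ρ := by
    -- The weak equation is assumed at positive times only; for `S = 0` the measure `ρ` is zero.
    rcases S.coe_nonneg.eq_or_lt with h0 | h0
    · simp [hρ, ← h0]
    · exact (intervalIntegrable_iff_integrableOn_Ioc_of_le h0.le).mp (hg.2 S h0 hSle ν).1
  obtain ⟨C, hC, hCle⟩ := exists_lintegral_enorm_poly_le hH
  have hCle' (ν : FiniteMeasure (EDelta E)) :
      ∫ s, |poly (H s) ν| ∂ρ ≤ C * (1 + (ν.mass : ℝ) ^ m) :=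
    integral_norm_le_of_lintegral_enorm_le (by positivity) (hH ν).1 (hCle ν)
  have hsm (r : ℝ≥0) : StronglyMeasurable (X r) := (hX.adapted r).mono (ℱ.le r)
  have hle {b : ℝ} (hb : b ∈ Icc (0 : ℝ) S) : t + b.toNNReal ≤ t + S :=
    add_le_add_right (Real.toNNReal_le_iff_le_coe.mpr hb.2) t
  have hJ {b : ℝ} (hb : b ∈ Icc (0 : ℝ) S) :
      Integrable (fun p : ℝ × Ω => poly (H p.1) (X (t + b.toNNReal) p.2)) (ρ.prod (P.restrict A)) :=
    (integrable_poly_prod hH (hsm _) hCle' ((hB _ (hle hb)).1.restrict (s := A))).1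
  have hshift (a : ℝ) {u : ℝ} (hu : 0 ≤ u) :
      ∫ ω in A, poly (H a) (X ((t : ℝ) + u).toNNReal ω) ∂P =
        ∫ ω in A, poly (H a) (X (t + u.toNNReal) ω) ∂P := by
    rw [Real.toNNReal_add t.coe_nonneg hu, Real.toNNReal_coe]
  have h0 : (0 : ℝ) ∈ Icc (0 : ℝ) S := left_mem_Icc.mpr S.coe_nonneg
  have key := eq_swap_of_partial_integrals_eq
    (f := fun a b => ∫ ω in A, poly (g a : Coeff (EDelta E) m) (X (t + b.toNNReal) ω) ∂P)
    (ψ := fun a b => ∫ ω in A, poly (H a) (X (t + b.toNNReal) ω) ∂P) S.coe_nonneg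
    -- Derivative in `a`: the weak equation with the random measure `X (t + b)` as test measure,
    -- followed by Fubini.
    (fun a ha b hb => by
      rcases ha.1.eq_or_lt with rfl | ha0
      · simp
      have hJa : Integrable (fun p : ℝ × Ω => poly (H p.1) (X (t + b.toNNReal) p.2))
          ((volume.restrict (Ioc 0 a)).prod (P.restrict A)) :=
        (hJ hb).mono_measure (Measure.prod_mono
          (Measure.restrict_mono (Ioc_subset_Ioc_right ha.2) le_rfl) le_rfl)
      have hsol (ω : Ω) := (hg.2 a ha0 (ha.2.trans hSle) (X (t + b.toNNReal) ω)).2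
      simp only [hsol, intervalIntegral.integral_of_le ha0.le]
      have hint : Integrable (fun ω => poly (g 0 : Coeff (EDelta E) m) (X (t + b.toNNReal) ω))
          (P.restrict A) :=
        ((hX.integrable_uncurry hB (continuous_poly _) (abs_poly_le _)).1 _ (hle hb)).restrict
      rw [integral_add hint hJa.integral_prod_right]
      congr 1
      exact integral_integral_swap
        (f := fun ω s => poly (H s) (X (t + b.toNNReal) ω)) hJa.swap)
    -- Derivative in `b`: the martingale identity on `[t, t + b]` for the fixed coefficient `g a`,
    -- after shifting time by `t`.
    (fun a ha b hb => by
      have h1 := hX.setIntegral_poly_closure hL hD1 hLm hcl hB (le_self_add (a := t) (b := b.toNNReal))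
        (hle hb) hA (g a)
      simp only [Real.toNNReal_zero, add_zero]
      rw [h1]
      congr 1
      have h2 := intervalIntegral.integral_comp_add_left (a := 0) (b := b)
        (fun r => ∫ ω in A, poly (H a) (X r.toNNReal ω) ∂P) (t : ℝ)
      rw [NNReal.coe_add, Real.coe_toNNReal _ hb.1, ← add_zero (t : ℝ), add_assoc, zero_add]
      refine h2.symm.trans (intervalIntegral.integral_congr fun u hu => ?_)
      rw [uIcc_of_le hb.1] at hu
      exact hshift a hu.1)
    (hX.integrable_poly_triple hC A hB hH hCle')
    ((intervalIntegrable_iff_integrableOn_Ioc_of_le S.coe_nonneg).mpr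
      (hJ h0).integral_prod_left)
    (by
      have h1 := (hX.integrable_prod_restrict hB (continuous_poly (H 0)) (abs_poly_le _) t le_rfl
        A).integral_prod_left
      have h2 : IntervalIntegrable (fun r => ∫ ω in A, poly (H 0) (X r.toNNReal ω) ∂P) volume t
          ((t + S : ℝ≥0) : ℝ) :=
        (intervalIntegrable_iff_integrableOn_Ioc_of_le (by rw [NNReal.coe_add]; simp)).mpr h1
      have h3 := h2.comp_add_left (t : ℝ)
      rw [NNReal.coe_add, sub_self, add_sub_cancel_left] at h3
      refine h3.congr fun u hu => ?_
      rw [uIoc_of_le S.coe_nonneg] at hu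
      exact hshift 0 hu.1.le)
  simpa only [Real.toNNReal_zero, add_zero, Real.toNNReal_coe, hg.1] using key

end Duality

end

theorem theorem5p5 {E : Type*} [TopologicalSpace E] [PolishSpace E] [LocallyCompactSpace E]
    [MeasurableSpace E] [BorelSpace E]
    (D : Submodule ℝ C(EDelta E, ℝ)) (hD : Dense (D : Set C(EDelta E, ℝ)))
    (hD1 : (1 : C(EDelta E, ℝ)) ∈ D)
    (L : cylDomain D →ₗ[ℝ] measurableMaps (EDelta E))
    (hL : IsPolynomialOperator D (MPlus E) L)
    (m : ℕ) (Lm : Coeff (EDelta E) m →ₗ.[ℝ] Coeff (EDelta E) m)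
    (hLm : IsDualOperator D (MPlus E) L m Lm) (hcl : Lm.IsClosable)
    {Ω : Type*} [mΩ : MeasurableSpace Ω] (P : Measure Ω) [IsProbabilityMeasure P]
    (ℱ : Filtration ℝ≥0 mΩ) (ν₀ : FiniteMeasure (EDelta E))
    (X : ℝ≥0 → Ω → FiniteMeasure (EDelta E)) (hX : SolvesMartingaleProblem L P ℱ ν₀ X)
    (T : ℝ≥0) (g₀ : Lm.closure.domain) (g : ℝ → Lm.closure.domain)
    (hg : IsWeakSolution Lm.closure T g₀ g) (t : ℝ≥0) (ht : t ≤ T) :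
    Integrable (fun ω => poly (g₀ : Coeff (EDelta E) m) (X T ω)) P ∧
    P[fun ω => poly (g₀ : Coeff (EDelta E) m) (X T ω) | ℱ t] =ᵐ[P]
      fun ω => poly (g ((T : ℝ) - t) : Coeff (EDelta E) m) (X t ω) := by
  obtain ⟨S, rfl⟩ := exists_add_of_le ht
  obtain ⟨B, -, hB⟩ := hX.exists_integral_mass_pow_le hD1 (hL.exists_abs_massPow_le hD1) m (t + S)
  have hint (h : Coeff (EDelta E) m) := (hX.integrable_uncurry hB (continuous_poly h)
    (abs_poly_le h)).1
  refine ⟨hint _ _ le_rfl, ?_⟩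
  rw [NNReal.coe_add, add_sub_cancel_left]
  -- The right side is measurable for `ℱ t`, so equality of integrals over all sets of `ℱ t`
  -- characterises it as the conditional expectation.
  exact (ae_eq_condExp_of_forall_setIntegral_eq (ℱ.le t) (hint _ _ le_rfl)
    (fun A _ _ => (hint _ _ ht).integrableOn)
    (fun A hA _ => hX.setIntegral_poly_weakSolution hL hD1 hLm hcl hg hA)
    (hX.stronglyMeasurable_comp (continuous_poly _) t).aestronglyMeasurable).symm
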